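/- Let $d\ge 1$ be an integer and $\alpha\in(0,1)$. For $u\in\ell^2(\mathbb Z^d)$ (real-valued) let $\hat u(\theta)=\sum_{x\in\mathbb Z^d}u(x)e^{ix\cdot\theta}$ (convergence in $L^2([-\pi,\pi]^d)$) be its discrete Fourier transform, let $\Phi(\theta)=\sum_{i=1}^d 4\sin^2(\theta_i/2)$, and let $(-\Delta)^\alpha u$ be the function on $\mathbb Z^d$ whose Fourier transform is $\Phi^\alpha\hat u$, i.e. $$(-\Delta)^\alpha u(x)=\frac1{(2\pi)^d}\int_{[-\pi,\pi]^d}\Phi(\theta)^\alpha\,\hat u(\theta)\,e^{-ix\cdot\theta}\,d\theta .$$ Let $h:\mathbb Z^d\to\mathbb R$ and $f:\mathbb Z^d\times\mathbb R\to\mathbb R$, and put $F(x,u)=\int_0^u f(x,t)\,dt$. Assume: - ($h_1$) there are constants $c_1,c_2>0$ with $c_1\le h(x)\le c_2$ for all $x\in\mathbb Z^d$; - ($f_1$) $f(x,\cdot)$ is continuous on $\mathbb R$ for every $x$; - ($f_2$) there are $a>0$ and $p>2$ with $|f(x,u)|\le a(1+|u|^{p-1})$ for all $x,u$; - ($f_3$)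 $f(x,u)=o(u)$ as $|u|\to0$, uniformly in $x$; - ($f_4$) for every $x$, $u\mapsto f(x,u)/|u|$ is strictly increasing on $(-\infty,0)$ and on $(0,+\infty)$; - ($f_5$) $F(x,u)/u^2\to+\infty$ as $|u|\to+\infty$, uniformly in $x$; - ($f_6$) $h$ and $f$ are $1$-periodic in each coordinate $x_i$ of $x$, $1\le i\le d$; - $f$ is odd in $u$: $f(x,-u)=-f(x,u)$ for all $x,u$. Let $H^\alpha=\{u\in\ell^2(\mathbb Z^d):(2\pi)^{-d}\int_{[-\pi,\pi]^d}\Phi^\alpha|\hat u|^2\,d\theta+\sum_{x}h(x)|u(x)|^2<+\infty\}$, and let $\mathcal O(u)=\{u(\cdot-y):y\in\mathbb Z^d\}$ be the translation orbit of $u$. Then the equation $$(-\Delta)^\alpha u+h(x)u=f(x,u),\qquad x\in\mathbb Z^d,$$ has infinitely many pairs of geometrically distinct solutions in $H^\alpha$: there is a sequence $(u_n)_{n\in\mathbb N}$ of nonzero elements of $H^\alpha$ such that all the functions $u_n$ and $-u_n$ are solutions in $H^\alpha$, and all the orbits $\mathcal O(u_n),\ \mathcal O(-u_n)$, $n\in\mathbb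 N$, are pairwise disjoint. -/

import Mathlib

open MeasureTheory Set

noncomputable section

namespace DiscreteFractional

/-- The integer lattice `ℤ^d`. -/
abbrev Lattice (d : ℕ) : Type := Fin d → ℤ

/-- The real sequence space `ℓ²(ℤ^d)`. -/
abbrev Ell2 (d : ℕ) : Type := lp (fun _ : Lattice d => ℝ) 2

/-- The frequency cube `[-π, π]^d`. -/
def cube (d : ℕ) : Set (Fin d → ℝ) := Icc (fun _ => -Real.pi) (fun _ => Real.pi)

/-- Lebesgue measure on `[-π, π]^d`. -/
abbrev cubeMeasure (d : ℕ) : Measure (Fin d → ℝ) := volume.restrict (cube d)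

/-- The pairing `x · θ = ∑ xᵢ θᵢ`. -/
def pairing {d : ℕ} (x : Lattice d) (θ : Fin d → ℝ) : ℝ := ∑ i, (x i : ℝ) * θ i

/-- The character `θ ↦ e^{i x·θ}`. -/
def character {d : ℕ} (x : Lattice d) (θ : Fin d → ℝ) : ℂ :=
  Complex.exp (Complex.I * (pairing x θ : ℂ))

theorem memLp_character {d : ℕ} (x : Lattice d) :
    MemLp (character x) 2 (cubeMeasure d) := by
  have hfin : IsFiniteMeasure (cubeMeasure d) :=
    ⟨by
      rw [Measure.restrict_apply_univ]
      exact isCompact_Icc.measure_lt_top⟩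
  have hc : Continuous (character x) := by
    unfold character pairing
    fun_prop
  refine MemLp.of_bound hc.aestronglyMeasurable 1 (Filter.Eventually.of_forall fun θ => ?_)
  rw [character, mul_comm, Complex.norm_exp_ofReal_mul_I]

/-- The discrete Fourier transform `û = ∑ₓ u(x) e^{i x·θ}` of `u ∈ ℓ²(ℤ^d)`, the series being
summed in `L²([-π, π]^d)`. This is the continuous extension to `ℓ²` of the transform on `ℓ¹`. -/
def fourier {d : ℕ} (u : Ell2 d) : Lp ℂ 2 (cubeMeasure d) :=
  ∑' x : Lattice d, (u x : ℂ) • (memLp_character x).toLp (character x)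

/-- The inverse discrete Fourier transform
`(2π)^{-d} ∫_{[-π,π]^d} v(θ) e^{-i x·θ} dθ`. -/
def fourierInv {d : ℕ} (v : (Fin d → ℝ) → ℂ) (x : Lattice d) : ℂ :=
  (1 / (2 * Real.pi : ℂ) ^ d) *
    ∫ θ in cube d, v θ * Complex.exp (-(Complex.I * (pairing x θ : ℂ)))

/-- The symbol `Φ(θ) = ∑ᵢ 4 sin²(θᵢ / 2)` of the lattice Laplacian `-Δ`. -/
def symbol {d : ℕ} (θ : Fin d → ℝ) : ℝ := ∑ i, 4 * Real.sin (θ i / 2) ^ 2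

/-- The discrete fractional Laplacian: `(-Δ)^α u` is the function on `ℤ^d` with Fourier transform
`Φ^α û`. It is real for real `u`, but the Fourier formula computes it in `ℂ`. -/
def fracLaplacian {d : ℕ} (α : ℝ) (u : Ell2 d) (x : Lattice d) : ℂ :=
  fourierInv (fun θ => ((symbol θ ^ α : ℝ) : ℂ) * fourier u θ) x

/-- The space `H^α`: those `u ∈ ℓ²(ℤ^d)` for which both (nonnegative) terms of
`(2π)^{-d} ∫ Φ^α |û|² dθ + ∑ₓ h(x) |u(x)|²` are finite. -/
def HAlpha {d : ℕ} (α : ℝ) (h : Lattice d → ℝ) : Set (Ell2 d) :=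
  {u | IntegrableOn (fun θ => symbol θ ^ α * ‖fourier u θ‖ ^ 2) (cube d) ∧
    Summable fun x => h x * |u x| ^ 2}

/-- `u` solves `(-Δ)^α u + h(x) u = f(x, u)` at every point of `ℤ^d`. -/
def IsSolution {d : ℕ} (α : ℝ) (h : Lattice d → ℝ) (f : Lattice d → ℝ → ℝ) (u : Ell2 d) : Prop :=
  ∀ x : Lattice d, fracLaplacian α u x + ((h x * u x : ℝ) : ℂ) = ((f x (u x) : ℝ) : ℂ)

/-- The orbit `{u(· - y) : y ∈ ℤ^d}` of `u` under lattice translations. -/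
def orbit {d : ℕ} (u : Ell2 d) : Set (Lattice d → ℝ) :=
  range fun (y : Lattice d) (x : Lattice d) => u (x - y)

/-- Two functions are geometrically distinct if their translation orbits are disjoint. -/
def GeometricallyDistinct {d : ℕ} (u v : Ell2 d) : Prop := Disjoint (orbit u) (orbit v)

end DiscreteFractional

end

/-! On ℤ^d, 1-periodicity makes `h` and `f` independent of `x`. The equation becomes T u = g(u) u,
where T = (-Δ)^α + c is coercive, symmetric and translation invariant, and g(s) = f(s)/s is even,
continuous, zero at 0 and strictly increasing on [0, ∞). Hence F is convex as a function of s². For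
the energy E(u) = ⟨Tu,u⟩/2 - ∑ F(u(x)) and u in the Nehari set (u ≠ 0, ⟨Tu,u⟩ = ⟨g(u)u,u⟩) this
gives E(w) ≤ E(u) + (⟨Tw,w⟩ - ⟨g(u)w,w⟩)/2 for all w (`Problem.Nehari.action_le`), which replaces
any differentiation of E.

Each ray meets the Nehari set exactly once, so E induces an even function on the unit sphere of ℓ².
In place of a pseudo-gradient flow, the sphere is moved by the odd map sending v to the
normalization of T⁻¹(g(u)u), u being the Nehari point over v. The inequality above and
Cauchy–Schwarz show that a step lowers the energy by at least a constant times its squared length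
(`Problem.exists_descent_rate`), and fixed points are solutions.

Suppose the nonzero solutions formed finitely many orbits up to sign. Normalized solutions would
then be uniformly separated. Translations destroy compactness, but on a sublevel set two points with
small enough energy loss are either close or a fixed distance apart (`Problem.exists_clusters`):
otherwise, after moving a site where they differ to the origin, pointwise limits would produce two
distinct solutions that are too close. Therefore every trajectory converges, and a compact symmetric
set is covered by antipode-free compact sets and their antipodes, one pair per critical value
(`DescentSystem.genusLE`).

There would be finitely many critical values, whereas the unit sphere of an (m+1)-dimensional space
is not covered by m such pairs (`lusternik_schnirelmann`). The latter is proved with chains mod 2: a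
product of m coboundaries of odd functions evaluates to 1 on a fine triangulated hemisphere, while
such a cover would make it vanish on every simplex.

So no finite list exhausts the orbits up to sign (`Problem.infinite_orbits`), and solutions are
chosen one after another. Decay at infinity keeps u and -u in different orbits. -/

namespace DiscreteFractional

/-! ### Chains modulo two on lists of vertices -/

/-- Chains modulo two; a list of `k + 1` vertices is an ordered `k`-simplex. -/
abbrev Chain (X : Type*) : Type _ := List X →₀ ZMod 2

namespace Chain

variable {X Y : Type*}

/-- Linear extension of a map defined on simplices. -/
noncomputable def lin (φ : List X → Chain Y) : Chain X →ₗ[ZMod 2] Chain Y :=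
  Finsupp.linearCombination (ZMod 2) φ

/-- Evaluation of a cochain on a chain. -/
noncomputable def eval (φ : List X → ZMod 2) : Chain X →ₗ[ZMod 2] ZMod 2 :=
  Finsupp.linearCombination (ZMod 2) φ

/-- A simplex as a chain. -/
noncomputable def spx (l : List X) : Chain X := Finsupp.single l 1

@[simp] theorem lin_spx (φ : List X → Chain Y) (l : List X) : lin φ (spx l) = φ l := by
  simp [lin, spx]

@[simp] theorem eval_spx (φ : List X → ZMod 2) (l : List X) : eval φ (spx l) = φ l := by
  simp [eval, spx]

theorem hom_ext {M : Type*} [AddCommMonoid M] [Module (ZMod 2) M]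
    {f g : Chain X →ₗ[ZMod 2] M} (h : ∀ l, f (spx l) = g (spx l)) : f = g := by
  refine Finsupp.lhom_ext fun l b => ?_
  have : (Finsupp.single l b : Chain X) = b • spx l := by simp [spx]
  rw [this, map_smul, map_smul, h]

theorem add_self_eq_zero (c : Chain X) : c + c = 0 := by
  ext l
  exact CharTwo.add_self_eq_zero _

/-- Adjoin a first vertex. -/
noncomputable def cone (v : X) : Chain X →ₗ[ZMod 2] Chain X := lin fun l => spx (v :: l)

/-- Push-forward under a map of vertices. -/
noncomputable def push (h : X → Y) : Chain X →ₗ[ZMod 2] Chain Y := lin fun l => spx (l.map h)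

/-- The (augmented) boundary of a simplex. -/
noncomputable def bdryAux : List X → Chain X
  | [] => 0
  | v :: l => spx l + cone v (bdryAux l)

/-- The (augmented) boundary operator. -/
noncomputable def bdry : Chain X →ₗ[ZMod 2] Chain X := lin bdryAux

/-- The prism over a simplex between two maps. -/
noncomputable def prismAux (h k : X → Y) : List X → Chain Y
  | [] => 0
  | v :: l => spx (h v :: k v :: l.map k) + cone (h v) (prismAux h k l)

/-- The prism operator. -/
noncomputable def prism (h h' : X → Y) : Chain X →ₗ[ZMod 2] Chain Y := lin (prismAux h h')

theorem cone_spx (v : X) (l : List X) : cone v (spx l) = spx (v :: l) := by simp [cone]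

theorem push_spx (h : X → Y) (l : List X) : push h (spx l) = spx (l.map h) := by simp [push]

theorem bdry_spx_nil : bdry (spx ([] : List X)) = 0 := by simp [bdry, bdryAux]

theorem bdry_spx_cons (v : X) (l : List X) :
    bdry (spx (v :: l)) = spx l + cone v (bdry (spx l)) := by simp [bdry, bdryAux]

theorem prism_spx_nil (h h' : X → Y) : prism h h' (spx []) = 0 := by simp [prism, prismAux]

theorem prism_spx_cons (h h' : X → Y) (v : X) (l : List X) :
    prism h h' (spx (v :: l)) =
      spx (h v :: h' v :: l.map h') + cone (h v) (prism h h' (spx l)) := by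
  simp [prism, prismAux]

theorem bdry_cone (v : X) (c : Chain X) : bdry (cone v c) = c + cone v (bdry c) := by
  have : bdry ∘ₗ cone v = LinearMap.id + cone v ∘ₗ bdry :=
    hom_ext fun l => by simp [cone_spx, bdry_spx_cons]
  exact LinearMap.congr_fun this c

theorem prism_cone (h h' : X → Y) (v : X) (c : Chain X) :
    prism h h' (cone v c) =
      cone (h v) (cone (h' v) (push h' c)) + cone (h v) (prism h h' c) := by
  have : prism h h' ∘ₗ cone v =
      cone (h v) ∘ₗ cone (h' v) ∘ₗ push h' + cone (h v) ∘ₗ prism h h' :=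
    hom_ext fun l => by simp [cone_spx, prism_spx_cons, push_spx]
  exact LinearMap.congr_fun this c

theorem push_cone (h : X → Y) (v : X) (c : Chain X) :
    push h (cone v c) = cone (h v) (push h c) := by
  have : push h ∘ₗ cone v = cone (h v) ∘ₗ push h :=
    hom_ext fun l => by simp [cone_spx, push_spx]
  exact LinearMap.congr_fun this c

theorem bdry_push (h : X → Y) (c : Chain X) : bdry (push h c) = push h (bdry c) := by
  have : bdry ∘ₗ push h = push h ∘ₗ bdry := hom_ext fun l => by
    induction l with
    | nil => simp [push_spx, bdry_spx_nil]
    | cons v l ih =>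
      simp only [LinearMap.comp_apply] at ih ⊢
      rw [push_spx] at ih ⊢
      simp only [List.map_cons, bdry_spx_cons, map_add, push_cone, ih, push_spx]
  exact LinearMap.congr_fun this c

theorem push_push {Z : Type*} (h : X → Y) (k : Y → Z) (c : Chain X) :
    push k (push h c) = push (k ∘ h) c := by
  have : push k ∘ₗ push h = push (k ∘ h) := hom_ext fun l => by simp [push_spx]
  exact LinearMap.congr_fun this c

/-- The prism operator is a chain homotopy. -/
theorem bdry_prism (h h' : X → Y) (c : Chain X) :
    bdry (prism h h' c) + prism h h' (bdry c) = push h c + push h' c := by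
  have : bdry ∘ₗ prism h h' + prism h h' ∘ₗ bdry = push h + push h' := hom_ext fun l => by
    induction l with
    | nil =>
      simp [prism_spx_nil, bdry_spx_nil, push_spx, add_self_eq_zero]
    | cons v l ih =>
      simp only [LinearMap.comp_apply, LinearMap.add_apply, push_spx] at ih ⊢
      have e1 : bdry (prism h h' (spx (v :: l))) + prism h h' (bdry (spx (v :: l))) =
          spx (h' v :: l.map h') + cone (h v) (spx (l.map h') +
            (bdry (prism h h' (spx l)) + prism h h' (bdry (spx l)))) +
          (prism h h' (spx l) + prism h h' (spx l)) +
          (cone (h v) (cone (h' v) (push h' (bdry (spx l)))) +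
            cone (h v) (cone (h' v) (push h' (bdry (spx l))))) := by
        rw [prism_spx_cons, bdry_spx_cons, map_add, map_add, bdry_spx_cons, bdry_spx_cons,
          bdry_cone, prism_cone, ← push_spx, bdry_push]
        simp only [map_add]
        abel
      rw [e1, ih, add_self_eq_zero, add_self_eq_zero]
      have e2 : spx (l.map h') + (spx (l.map h) + spx (l.map h')) = spx (l.map h) := by
        rw [add_left_comm, add_self_eq_zero, add_zero]
      rw [e2, cone_spx]
      simp only [List.map_cons]
      abel
  exact LinearMap.congr_fun this c

theorem eval_lin (φ : List Y → ZMod 2) (F : List X → Chain Y) (c : Chain X) :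
    eval φ (lin F c) = eval (fun l => eval φ (F l)) c := by
  have : eval φ ∘ₗ lin F = eval (fun l => eval φ (F l)) := hom_ext fun l => by simp
  exact LinearMap.congr_fun this c

/-- Chains all of whose simplices satisfy `p`. -/
def On (p : List X → Prop) : Submodule (ZMod 2) (Chain X) :=
  Finsupp.supported (ZMod 2) (ZMod 2) {l | p l}

theorem spx_mem_on {p : List X → Prop} {l : List X} (hl : p l) : spx l ∈ On p :=
  Finsupp.single_mem_supported _ _ hl

theorem on_eq_span (p : List X → Prop) :
    On p = Submodule.span (ZMod 2) (spx '' {l | p l}) :=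
  Finsupp.supported_eq_span_single _ _

theorem map_mem_of_on {M : Type*} [AddCommMonoid M] [Module (ZMod 2) M]
    {p : List X → Prop} {S : Submodule (ZMod 2) M}
    {f : Chain X →ₗ[ZMod 2] M} (h : ∀ l, p l → f (spx l) ∈ S) {c : Chain X} (hc : c ∈ On p) :
    f c ∈ S := by
  rw [on_eq_span] at hc
  have : Submodule.span (ZMod 2) (spx '' {l | p l}) ≤ S.comap f := by
    rw [Submodule.span_le]
    rintro _ ⟨l, hl, rfl⟩
    exact h l hl
  exact this hc

theorem map_eq_of_on {M : Type*} [AddCommGroup M] [Module (ZMod 2) M]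
    {p : List X → Prop} {f g : Chain X →ₗ[ZMod 2] M}
    (h : ∀ l, p l → f (spx l) = g (spx l)) {c : Chain X} (hc : c ∈ On p) : f c = g c := by
  have : (f - g) c ∈ (⊥ : Submodule (ZMod 2) M) :=
    map_mem_of_on (fun l hl => by simp [h l hl]) hc
  simpa [sub_eq_zero] using this

/-! ### The product cochain -/

/-- The cochain `δβ_{k-1} ∪ ⋯ ∪ δβ_0` on `k`-simplices. -/
def cup (β : ℕ → X → ZMod 2) : ℕ → List X → ZMod 2
  | 0, [_] => 1
  | k + 1, v :: w :: l => (β k v + β k w) * cup β k (w :: l)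
  | _, _ => 0

/-- The cochain `β_k ∪ δβ_{k-1} ∪ ⋯ ∪ δβ_0`. -/
def cupPrim (β : ℕ → X → ZMod 2) (k : ℕ) : List X → ZMod 2
  | [] => 0
  | v :: l => β k v * cup β k (v :: l)

theorem eval_cone (φ : List X → ZMod 2) (v : X) (c : Chain X) :
    eval φ (cone v c) = eval (fun l => φ (v :: l)) c := by
  rw [cone, eval_lin]; simp

theorem eval_mul_left (φ : List X → ZMod 2) (a : ZMod 2) (c : Chain X) :
    eval (fun l => a * φ l) c = a * eval φ c := by
  have : eval (fun l => a * φ l) = a • eval φ := hom_ext fun l => by simp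
  rw [this]; rfl

theorem eval_bdry_cons_cons (φ : List X → ZMod 2) (v w : X) (l : List X) :
    eval φ (bdry (spx (v :: w :: l))) =
      φ (w :: l) + φ (v :: l) + eval (fun m => φ (v :: w :: m)) (bdry (spx l)) := by
  simp only [bdry_spx_cons, map_add, eval_spx, cone_spx, eval_cone, add_assoc]

/-- A product of coboundaries is a cocycle; this is the Leibniz rule checked on faces, by induction
on the number of factors. -/
theorem cup_bdry (β : ℕ → X → ZMod 2) (k : ℕ) :
    ∀ l : List X, l.length = k + 2 → eval (cup β k) (bdry (spx l)) = 0 := by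
  induction k with
  | zero =>
    intro l hl
    obtain ⟨v, w, rfl⟩ := List.length_eq_two.1 hl
    rw [eval_bdry_cons_cons]
    simp [cup, bdry_spx_nil]
    exact CharTwo.add_self_eq_zero _
  | succ k ih =>
    intro l hl
    match l, hl with
    | v :: w :: x :: l, hl =>
      rw [eval_bdry_cons_cons]
      have h1 := ih (w :: x :: l) (by simpa using hl)
      -- The faces keeping both `v` and `w` share the factor of the edge `vw`; by induction their
      -- remaining factors add up to the value on `x :: l`. What is left is that the coboundary of
      -- `β k` sums to zero around the triangle `vwx`.
      have h2 : eval (fun m => cup β (k + 1) (v :: w :: m)) (bdry (spx (x :: l))) =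
          (β k v + β k w) * cup β k (x :: l) := by
        simp only [cup]
        rw [eval_mul_left]
        congr 1
        rw [bdry_spx_cons, map_add, eval_spx, eval_cone] at h1
        exact (CharTwo.add_eq_zero.1 h1).symm
      rw [h2]
      simp only [cup]
      have h3 : ∀ a b c d : ZMod 2, (a + b) * d + (c + b) * d + (c + a) * d = 0 := by decide
      exact h3 _ _ _ _

/-- Leibniz rule again: only the first factor is not closed, so the coboundary falls on it alone. -/
theorem cupPrim_bdry (β : ℕ → X → ZMod 2) (k : ℕ) (l : List X) (hl : l.length = k + 2) :
    eval (cupPrim β k) (bdry (spx l)) = cup β (k + 1) l := by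
  match l, hl with
  | v :: w :: l, hl =>
    have h1 := cup_bdry β k (v :: w :: l) hl
    rw [eval_bdry_cons_cons] at h1 ⊢
    simp only [cupPrim, cup]
    rw [eval_mul_left]
    have h3 : ∀ a b c d e : ZMod 2, c + d + e = 0 →
      b * c + a * d + a * e = (a + b) * c := by decide
    exact h3 _ _ _ _ _ h1

end Chain

/-! ### A Lusternik–Schnirelmann theorem for spheres -/

namespace Chain

variable {E : Type*} [NormedAddCommGroup E] [InnerProductSpace ℝ E]

/-- Keeps track of dimension and vertices, from which norms and mesh of the hemispheres are
controlled. -/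
theorem prism_mem_on {X Y : Type*} (h h' : X → Y) (l : List X) :
    prism h h' (spx l) ∈
      On (fun m : List Y => m.length = l.length + 1 ∧ ∀ v ∈ m, ∃ x ∈ l, v = h x ∨ v = h' x) := by
  induction l with
  | nil => rw [prism_spx_nil]; exact Submodule.zero_mem _
  | cons a l ih =>
    rw [prism_spx_cons]
    refine Submodule.add_mem _ (spx_mem_on ⟨by simp, ?_⟩) ?_
    · intro v hv
      simp only [List.mem_cons, List.mem_map] at hv
      rcases hv with rfl | rfl | ⟨x, hx, rfl⟩
      · exact ⟨a, by simp, Or.inl rfl⟩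
      · exact ⟨a, by simp, Or.inr rfl⟩
      · exact ⟨x, by simp [hx], Or.inr rfl⟩
    · refine map_mem_of_on (f := cone (h a)) ?_ ih
      rintro m ⟨hm, hm'⟩
      rw [cone_spx]
      refine spx_mem_on ⟨by simp [hm], ?_⟩
      intro v hv
      rcases List.mem_cons.1 hv with rfl | hv
      · exact ⟨a, by simp, Or.inl rfl⟩
      · obtain ⟨x, hx, h⟩ := hm' v hv
        exact ⟨x, by simp [hx], h⟩

/-- Rotation of `x` towards the unit vector `e` by the angle `t`. -/
noncomputable def rot (e : E) (t : ℝ) (x : E) : E := Real.cos t • x + Real.sin t • e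

theorem norm_rot {e x : E} (he : ‖e‖ = 1) (hx : ‖x‖ = 1) (hxe : inner ℝ x e = 0) (t : ℝ) :
    ‖rot e t x‖ = 1 := by
  have : ‖rot e t x‖ ^ 2 = 1 := by
    rw [rot, norm_add_sq_real, inner_smul_left, inner_smul_right, hxe, norm_smul, norm_smul, he, hx]
    simp
  nlinarith [norm_nonneg (rot e t x)]

theorem norm_rot_sub_rot_le {e : E} (he : ‖e‖ = 1) {x y : E} (hy : ‖y‖ = 1) (s t : ℝ) :
    ‖rot e s x - rot e t y‖ ≤ ‖x - y‖ + 2 * |s - t| := by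
  have h1 : rot e s x - rot e t y = Real.cos s • (x - y) +
      ((Real.cos s - Real.cos t) • y + (Real.sin s - Real.sin t) • e) := by
    simp only [rot, smul_sub, sub_smul]; abel
  have h2 : |Real.cos s - Real.cos t| ≤ |s - t| := by
    simpa [Real.dist_eq] using Real.lipschitzWith_cos.dist_le_mul s t
  have h3 : |Real.sin s - Real.sin t| ≤ |s - t| := by
    simpa [Real.dist_eq] using Real.lipschitzWith_sin.dist_le_mul s t
  rw [h1]
  refine (norm_add_le _ _).trans (add_le_add ?_ ((norm_add_le _ _).trans ?_))
  · rw [norm_smul]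
    exact mul_le_of_le_one_left (norm_nonneg _) (Real.abs_cos_le_one s)
  · rw [norm_smul, norm_smul, he, hy, Real.norm_eq_abs, Real.norm_eq_abs]
    linarith

/-- Simplices of mesh at most `k θ` in the unit sphere of the span of `e 0, …, e k`. -/
def Small (e : ℕ → E) (θ : ℝ) (k : ℕ) (l : List E) : Prop :=
  l.length = k + 1 ∧ (∀ v ∈ l, ‖v‖ = 1 ∧ v ∈ Submodule.span ℝ (e '' Iic k)) ∧
    ∀ v ∈ l, ∀ w ∈ l, ‖v - w‖ ≤ k * θ

/-- A finely triangulated hemisphere of the unit sphere in the span of `e 0, …, e k`. -/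
noncomputable def hemisphere (e : ℕ → E) (N : ℕ) : ℕ → Chain E
  | 0 => spx [e 0]
  | k + 1 => ∑ j ∈ Finset.range N,
      prism (rot (e (k + 1)) (j * (Real.pi / 2 / N))) (rot (e (k + 1)) ((j + 1) * (Real.pi / 2 / N)))
        (hemisphere e N k + push Neg.neg (hemisphere e N k))

theorem push_neg_mem_on_small {e : ℕ → E} {θ : ℝ} {k : ℕ} {c : Chain E}
    (hc : c ∈ On (Small e θ k)) : push Neg.neg c ∈ On (Small e θ k) := by
  refine map_mem_of_on ?_ hc
  rintro l ⟨h1, h2, h3⟩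
  rw [push_spx]
  refine spx_mem_on ⟨by simpa using h1, ?_, ?_⟩
  · intro v hv
    obtain ⟨x, hx, rfl⟩ := List.mem_map.1 hv
    exact ⟨by rw [norm_neg]; exact (h2 x hx).1, Submodule.neg_mem _ (h2 x hx).2⟩
  · intro v hv w hw
    obtain ⟨x, hx, rfl⟩ := List.mem_map.1 hv
    obtain ⟨y, hy, rfl⟩ := List.mem_map.1 hw
    rw [neg_sub_neg, norm_sub_rev]
    exact h3 x hx y hy

theorem inner_eq_zero_of_mem_span {e : ℕ → E} (he : Orthonormal ℝ e) {k : ℕ} {x : E}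
    (hx : x ∈ Submodule.span ℝ (e '' Iic k)) : inner ℝ x (e (k + 1)) = 0 := by
  induction hx using Submodule.span_induction with
  | mem y hy =>
    obtain ⟨j, hj, rfl⟩ := hy
    exact he.2 (by simp at hj; omega)
  | zero => simp
  | add y z _ _ hy hz => rw [inner_add_left, hy, hz, add_zero]
  | smul a y _ hy => rw [inner_smul_left, hy, mul_zero]

/-- Each new dimension is swept out in slices of angle π/(2N), and a slice enlarges the mesh by at
most twice its angle, whence π/N per dimension. -/
theorem hemisphere_mem_on {e : ℕ → E} (he : Orthonormal ℝ e) (N : ℕ) (k : ℕ) :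
    hemisphere e N k ∈ On (Small e (Real.pi / N) k) := by
  induction k with
  | zero =>
    refine spx_mem_on ⟨rfl, ?_, ?_⟩
    · intro v hv
      rw [List.mem_singleton.1 hv]
      exact ⟨he.1 0, Submodule.subset_span ⟨0, by simp, rfl⟩⟩
    · intro v hv w hw
      rw [List.mem_singleton.1 hv, List.mem_singleton.1 hw]
      simp
  | succ k ih =>
    refine Submodule.sum_mem _ fun j _ => ?_
    refine map_mem_of_on ?_ (Submodule.add_mem _ ih (push_neg_mem_on_small ih))
    rintro l ⟨h1, h2, h3⟩
    have key := prism_mem_on (rot (e (k + 1)) (j * (Real.pi / 2 / N)))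
      (rot (e (k + 1)) ((j + 1) * (Real.pi / 2 / N))) l
    refine (Finsupp.supported_mono ?_ : On _ ≤ On _) key
    rintro m ⟨hm1, hm2⟩
    have hm3 : ∀ v ∈ m, ∃ x ∈ l, ∃ t : ℝ, v = rot (e (k + 1)) t x ∧
        (t = j * (Real.pi / 2 / N) ∨ t = (j + 1) * (Real.pi / 2 / N)) := by
      intro v hv
      obtain ⟨x, hx, h | h⟩ := hm2 v hv
      · exact ⟨x, hx, _, h, Or.inl rfl⟩
      · exact ⟨x, hx, _, h, Or.inr rfl⟩
    refine ⟨by omega, ?_, ?_⟩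
    · intro v hv
      obtain ⟨x, hx, t, rfl, -⟩ := hm3 v hv
      refine ⟨norm_rot (he.1 _) (h2 x hx).1 (inner_eq_zero_of_mem_span he (h2 x hx).2) t, ?_⟩
      refine Submodule.add_mem _ (Submodule.smul_mem _ _ ?_)
        (Submodule.smul_mem _ _ (Submodule.subset_span ⟨k + 1, by simp, rfl⟩))
      exact Submodule.span_mono (image_mono (Iic_subset_Iic.2 (Nat.le_succ k))) (h2 x hx).2
    · intro v hv w hw
      obtain ⟨x, hx, s, rfl, hs⟩ := hm3 v hv
      obtain ⟨y, hy, t, rfl, ht⟩ := hm3 w hw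
      refine (norm_rot_sub_rot_le (he.1 _) (h2 y hy).1 s t).trans ?_
      have h4 := h3 x hx y hy
      have h5 : 0 ≤ Real.pi / 2 / N := by positivity
      have h6 : |s - t| ≤ Real.pi / 2 / N := by
        rw [abs_le]
        rcases hs with rfl | rfl <;> rcases ht with rfl | rfl <;> constructor <;> linarith
      have h7 : Real.pi / N = 2 * (Real.pi / 2 / N) := by ring
      push_cast
      rw [add_mul, one_mul]
      linarith

/-- On a cycle each prism is bounded by its two ends, and the intermediate ends cancel in pairs mod
2. -/
theorem bdry_sum_prism {X Y : Type*} (h : ℕ → X → Y) (z : Chain X) (hz : bdry z = 0) (N : ℕ) :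
    bdry (∑ j ∈ Finset.range N, prism (h j) (h (j + 1)) z) = push (h 0) z + push (h N) z := by
  induction N with
  | zero => simp [add_self_eq_zero]
  | succ N ih =>
    rw [Finset.sum_range_succ, map_add, ih]
    have := bdry_prism (h N) (h (N + 1)) z
    rw [hz, map_zero, add_zero] at this
    rw [this]
    calc push (h 0) z + push (h N) z + (push (h N) z + push (h (N + 1)) z)
        = push (h 0) z + push (h (N + 1)) z + (push (h N) z + push (h N) z) := by abel
      _ = _ := by rw [add_self_eq_zero, add_zero]

theorem push_id_of_eq {X : Type*} {h : X → X} (hh : ∀ x, h x = x) (c : Chain X) :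
    push h c = c := by
  have : push h = LinearMap.id := hom_ext fun l => by
    rw [push_spx]
    have : h = id := funext hh
    simp [this]
  rw [this]; rfl

theorem bdry_hemisphere_of_cycle {e : ℕ → E} {N : ℕ} (hN : 0 < N) {k : ℕ}
    (hz : bdry (hemisphere e N k + push Neg.neg (hemisphere e N k)) = 0) :
    bdry (hemisphere e N (k + 1)) = hemisphere e N k + push Neg.neg (hemisphere e N k) := by
  have hk := bdry_sum_prism (fun j : ℕ => rot (e (k + 1)) (j * (Real.pi / 2 / N))) _ hz N
  have h0 : ∀ x, rot (e (k + 1)) (((0 : ℕ) : ℝ) * (Real.pi / 2 / N)) x = x := by simp [rot]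
  have hN' : (N : ℝ) * (Real.pi / 2 / N) = Real.pi / 2 := by field_simp
  -- At angle π/2 everything collapses to the pole. The two opposite halves of the equator then have
  -- the same degenerate image, which cancels mod 2; only the end at angle 0, the equator itself,
  -- survives.
  have h1 : rot (e (k + 1)) ((N : ℝ) * (Real.pi / 2 / N)) = fun _ => e (k + 1) := by
    funext x; simp [rot, hN']
  simp only [h1, push_id_of_eq h0, map_add] at hk
  rw [push_push, show ((fun _ : E => e (k + 1)) ∘ Neg.neg) = fun _ : E => e (k + 1) from rfl,
    add_self_eq_zero, add_zero] at hk
  simpa only [hemisphere, Nat.cast_add, Nat.cast_one, map_add] using hk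

/-- The boundary of a hemisphere is the equator, the union of two opposite hemispheres. -/
theorem bdry_hemisphere {e : ℕ → E} {N : ℕ} (hN : 0 < N) (k : ℕ) :
    bdry (hemisphere e N (k + 1)) = hemisphere e N k + push Neg.neg (hemisphere e N k) := by
  refine bdry_hemisphere_of_cycle hN ?_
  induction k with
  | zero => simp [hemisphere, push_spx, bdry_spx_cons, bdry_spx_nil, add_self_eq_zero]
  | succ k ih =>
    rw [map_add, bdry_push, bdry_hemisphere_of_cycle hN ih, map_add, push_push,
      push_id_of_eq (h := Neg.neg ∘ Neg.neg) (fun x => neg_neg x),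
      add_comm (push Neg.neg _), add_self_eq_zero]

/-- The antipodal map adds 1 at both ends of an edge, so every coboundary factor is invariant. -/
theorem cup_neg {V : Type*} [NormedAddCommGroup V] {β : ℕ → V → ZMod 2} (hβ : ∀ k x, ‖x‖ = 1 → β k (-x) = β k x + 1) (k : ℕ) :
    ∀ l : List V, (∀ v ∈ l, ‖v‖ = 1) → cup β k (l.map Neg.neg) = cup β k l := by
  induction k with
  | zero =>
    rintro (_ | ⟨v, _ | ⟨w, l⟩⟩) - <;> simp [cup]
  | succ k ih =>
    rintro (_ | ⟨v, _ | ⟨w, l⟩⟩) hl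
    · simp [cup]
    · simp [cup]
    · have := ih (w :: l) fun v hv => hl v (by simp [List.mem_cons.1 hv])
      simp only [List.map_cons, cup] at this ⊢
      rw [this, hβ k v (hl v (by simp)), hβ k w (hl w (by simp))]
      have h3 : ∀ a b : ZMod 2, a + 1 + (b + 1) = a + b := by decide
      rw [h3]

/-- The product of the coboundaries of odd functions does not vanish on the sphere. -/
theorem eval_cup_hemisphere {e : ℕ → E} (he : Orthonormal ℝ e) {N : ℕ} (hN : 0 < N)
    {β : ℕ → E → ZMod 2} (hβ : ∀ k x, ‖x‖ = 1 → β k (-x) = β k x + 1) (k : ℕ) :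
    eval (cup β k) (hemisphere e N k) = 1 := by
  induction k with
  | zero => simp [hemisphere, cup]
  | succ k ih =>
    -- Stokes: the evaluation moves to the equator, two opposite copies of the lower hemisphere.
    have h1 : eval (cup β (k + 1)) (hemisphere e N (k + 1)) =
        eval (cupPrim β k) (bdry (hemisphere e N (k + 1))) := by
      refine map_eq_of_on (g := eval (cupPrim β k) ∘ₗ bdry) ?_ (hemisphere_mem_on he N (k + 1))
      intro l hl
      rw [LinearMap.comp_apply, cupPrim_bdry β k l hl.1, eval_spx]
    rw [h1, bdry_hemisphere hN, ← ih]
    refine map_eq_of_on (f := eval (cupPrim β k) ∘ₗ (LinearMap.id + push Neg.neg)) ?_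
      (hemisphere_mem_on he N k)
    rintro l ⟨hl, hl', -⟩
    simp only [LinearMap.comp_apply, LinearMap.add_apply, LinearMap.id_apply, push_spx, map_add,
      eval_spx]
    match l, hl with
    | v :: l, hl =>
      have h2 := cup_neg hβ k (v :: l) fun w hw => (hl' w hw).1
      simp only [List.map_cons] at h2 ⊢
      simp only [cupPrim]
      rw [h2, hβ k v (hl' v (by simp)).1]
      -- The primitive takes values differing by the product itself on opposite simplices, so the
      -- two halves add up to the product of one degree less.
      have h3 : ∀ a b : ZMod 2, a * b + (a + 1) * b = b := by decide
      exact h3 _ _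

/-- If one `β i` is constant on the vertices, its coboundary factor vanishes on the edge it is
applied to. -/
theorem cup_eq_zero {X : Type*} {β : ℕ → X → ZMod 2} {i : ℕ} {b : ZMod 2} (k : ℕ) (hi : i < k) :
    ∀ l : List X, (∀ v ∈ l, β i v = b) → cup β k l = 0 := by
  induction k with
  | zero => omega
  | succ k ih =>
    rintro (_ | ⟨v, _ | ⟨w, l⟩⟩) hl
    · simp [cup]
    · simp [cup]
    · simp only [cup]
      rcases Nat.lt_succ_iff_lt_or_eq.1 hi with h | rfl
      · rw [ih h (w :: l) fun v hv => hl v (by simp [List.mem_cons.1 hv]), mul_zero]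
      · rw [hl v (by simp), hl w (by simp), CharTwo.add_self_eq_zero, zero_mul]

end Chain

open Chain in
/-- The unit sphere of the span of `e 0, …, e m` is not covered by `m` sets, each well separated
from its antipodal set, together with these antipodal sets. -/
theorem lusternik_schnirelmann {E : Type*} [NormedAddCommGroup E] [InnerProductSpace ℝ E]
    {e : ℕ → E} (he : Orthonormal ℝ e) (m : ℕ) (C : ℕ → Set E) {ε : ℝ} (hε : 0 < ε)
    (hsep : ∀ i < m, ∀ x ∈ C i, ∀ y ∈ C i, ε ≤ ‖x + y‖)
    (hcov : ∀ x ∈ Submodule.span ℝ (e '' Iic m), ‖x‖ = 1 → ∃ i < m, x ∈ C i ∨ -x ∈ C i) :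
    False := by
  classical
  obtain ⟨N, hN⟩ := exists_nat_gt (3 * m * Real.pi / ε + 1)
  have hNpos : (0 : ℝ) < N := lt_of_le_of_lt (by positivity) hN
  have hN0 : 0 < N := by exact_mod_cast hNpos
  have hmesh : m * (Real.pi / N) < ε / 3 := by
    have : 3 * m * Real.pi / ε < N := by linarith
    rw [div_lt_iff₀ hε] at this
    rw [mul_div_assoc', div_lt_div_iff₀ hNpos (by norm_num)]
    linarith
  -- If `x` and `-x` were both near `C i`, two points of `C i` would have a sum of norm below 2ε/3,
  -- against `hsep`.
  let near : ℕ → E → Prop := fun i x => ∃ y ∈ C i, ‖x - y‖ < ε / 3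
  have hnear : ∀ i < m, ∀ x, near i x → ¬ near i (-x) := by
    rintro i hi x ⟨y, hy, hxy⟩ ⟨z, hz, hxz⟩
    have h1 := hsep i hi y hy z hz
    have h2 : y + z = -((x - y) + (-x - z)) := by abel
    rw [h2, norm_neg] at h1
    linarith [norm_add_le (x - y) (-x - z)]
  -- An odd function equal to 1 near `C i` and 0 near its antipode. Elsewhere a well-ordering
  -- chooses one of each antipodal pair; no continuity is needed since chains only see vertices.
  let β : ℕ → E → ZMod 2 := fun i x =>
    if i < m ∧ near i x then 1 else if i < m ∧ near i (-x) then 0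
      else if WellOrderingRel x (-x) then 1 else 0
  have hβ : ∀ k x, ‖x‖ = 1 → β k (-x) = β k x + 1 := by
    intro k x hx
    have hne : x ≠ -x := by
      intro h
      have : x = 0 := by
        have h2 : (2 : ℝ) • x = 0 := by
          rw [two_smul]; nth_rewrite 2 [h]; exact add_neg_cancel x
        simpa using h2
      rw [this, norm_zero] at hx
      exact zero_ne_one hx
    have h11 : (1 : ZMod 2) + 1 = 0 := by decide
    simp only [β, neg_neg]
    by_cases h1 : k < m ∧ near k x
    · rw [if_pos h1, if_pos h1, if_neg fun h => hnear k h1.1 x h1.2 h.2, h11]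
    by_cases h2 : k < m ∧ near k (-x)
    · rw [if_pos h2, if_neg h1, if_pos h2, zero_add]
    rw [if_neg h2, if_neg h1, if_neg h1, if_neg h2]
    rcases trichotomous_of WellOrderingRel x (-x) with h | h | h
    · rw [if_pos h, if_neg (fun h' => asymm_of WellOrderingRel h h'), h11]
    · exact absurd h hne
    · rw [if_pos h, if_neg (fun h' => asymm_of WellOrderingRel h h'), zero_add]
  have h1 := eval_cup_hemisphere he hN0 hβ m
  have h0 : eval (cup β m) (hemisphere e N m) = 0 := by
    refine map_eq_of_on (g := 0) ?_ (hemisphere_mem_on he N m)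
    rintro l ⟨hl, hl1, hl2⟩
    rw [eval_spx, LinearMap.zero_apply]
    -- One vertex lies in some `C i` or its antipode, and the mesh is below ε/3, so `β i` is
    -- constant on the whole simplex.
    obtain ⟨v, hv⟩ := List.exists_mem_of_length_pos (l := l) (by omega)
    obtain ⟨i, hi, h | h⟩ := hcov v (hl1 v hv).2 (hl1 v hv).1
    · refine cup_eq_zero (i := i) (b := 1) m hi l fun w hw => ?_
      exact if_pos ⟨hi, v, h, (hl2 w hw v hv).trans_lt hmesh⟩
    · refine cup_eq_zero (i := i) (b := 0) m hi l fun w hw => ?_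
      have h2 : near i (-w) := ⟨-v, h, by
        rw [neg_sub_neg]; exact (hl2 v hv w hw).trans_lt hmesh⟩
      simp only [β]
      rw [if_neg fun h' => hnear i hi w h'.2 h2, if_pos ⟨hi, h2⟩]
  rw [h0] at h1
  exact zero_ne_one h1

/-! ### Odd descent systems and the genus of compact sets -/

section Descent

open Filter Topology

/-- `A` is covered by `n` compact sets that contain no antipodal pair and their antipodal sets. -/
def GenusLE {X : Type*} [TopologicalSpace X] [Neg X] (A : Set X) (n : ℕ) : Prop :=
  ∃ C : ℕ → Set X, (∀ i < n, IsCompact (C i) ∧ ∀ x ∈ C i, -x ∉ C i) ∧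
    ∀ x ∈ A, ∃ i < n, x ∈ C i ∨ -x ∈ C i

/-- An odd map pulls antipode-free sets back to antipode-free sets; intersecting with the compact
set `A` restores compactness. This permits replacing `A` by its image under iterates of the descent
map. -/
theorem GenusLE.comap {X Y : Type*} [TopologicalSpace X] [Neg X] [TopologicalSpace Y] [T2Space Y]
    [Neg Y] {φ : X → Y} (hφ : Continuous φ) (hodd : ∀ x, φ (-x) = -φ x) {A : Set X}
    (hA : IsCompact A) (hneg : ∀ x ∈ A, -x ∈ A) {n : ℕ} (h : GenusLE (φ '' A) n) :
    GenusLE A n := by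
  obtain ⟨C, hC, hcov⟩ := h
  refine ⟨fun i => A ∩ φ ⁻¹' C i, fun i hi => ⟨hA.inter_right ((hC i hi).1.isClosed.preimage hφ),
    fun x hx hx' => (hC i hi).2 (φ x) hx.2 (by rw [← hodd]; exact hx'.2)⟩, fun x hx => ?_⟩
  obtain ⟨i, hi, h | h⟩ := hcov (φ x) (mem_image_of_mem _ hx)
  · exact ⟨i, hi, Or.inl ⟨hx, h⟩⟩
  · exact ⟨i, hi, Or.inr ⟨hneg x hx, by rw [mem_preimage, hodd]; exact h⟩⟩

/-- An odd self-map of a metric space that decreases an even continuous function, and whose nearly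
stationary points form well separated clusters on every sublevel set. -/
structure DescentSystem (X : Type*) [MetricSpace X] [InvolutiveNeg X] where
  /-- the map -/
  map : X → X
  /-- the energy -/
  energy : X → ℝ
  /-- the rate of descent -/
  rate : ℝ
  dist_neg : ∀ x y : X, dist (-x) (-y) = dist x y
  continuous_map : Continuous map
  continuous_energy : Continuous energy
  map_neg : ∀ x, map (-x) = -map x
  energy_neg : ∀ x, energy (-x) = energy x
  energy_nonneg : ∀ x, 0 ≤ energy x
  rate_pos : 0 < rate
  descent : ∀ x, rate * dist (map x) x ^ 2 ≤ energy x - energy (map x)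
  clusters : ∀ D : ℝ, ∃ κ : ℝ, 0 < κ ∧ ∀ ε : ℝ, 0 < ε → ∃ δ : ℝ, 0 < δ ∧ ∀ x y,
    energy x ≤ D → energy y ≤ D → energy x - energy (map x) ≤ δ → energy y - energy (map y) ≤ δ →
      dist x y < ε ∨ κ ≤ dist x y

namespace DescentSystem

variable {X : Type*} [MetricSpace X] [InvolutiveNeg X] (S : DescentSystem X)

theorem energy_map_le (x : X) : S.energy (S.map x) ≤ S.energy x := by
  have := S.descent x
  have h2 : 0 ≤ S.rate * dist (S.map x) x ^ 2 := mul_nonneg S.rate_pos.le (sq_nonneg _)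
  linarith

theorem energy_iterate_succ_le (x : X) (n : ℕ) :
    S.energy (S.map^[n + 1] x) ≤ S.energy (S.map^[n] x) := by
  rw [Function.iterate_succ_apply']
  exact S.energy_map_le _

theorem antitone_energy (x : X) : Antitone fun n => S.energy (S.map^[n] x) :=
  antitone_nat_of_succ_le (S.energy_iterate_succ_le x)

theorem iterate_neg (x : X) (n : ℕ) : S.map^[n] (-x) = -S.map^[n] x := by
  induction n with
  | zero => rfl
  | succ n ih => rw [Function.iterate_succ_apply', ih, S.map_neg, Function.iterate_succ_apply']

theorem continuous_iterate (n : ℕ) : Continuous (S.map^[n]) := S.continuous_map.iterate n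

/-- A trajectory that loses little energy stays close to its starting point. -/
theorem exists_dist_iterate_lt (D : ℝ) {r : ℝ} (hr : 0 < r) : ∃ ε : ℝ, 0 < ε ∧ ∀ x,
    S.energy x ≤ D → ∀ n, S.energy x - S.energy (S.map^[n] x) < ε → dist (S.map^[n] x) x < r := by
  obtain ⟨κ, hκ, hcl⟩ := S.clusters D
  -- With 2ρ ≤ κ, a step shorter than ρ starting in the ρ-ball around `x` cannot cross the gap
  -- between distances ρ and κ, so the trajectory stays in that ball.
  set ρ := min (r / 2) (κ / 2) with hρ
  have hρ0 : 0 < ρ := by positivity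
  have hρr : 2 * ρ ≤ r := by linarith [min_le_left (r / 2) (κ / 2)]
  have hρκ : 2 * ρ ≤ κ := by linarith [min_le_right (r / 2) (κ / 2)]
  obtain ⟨δ, hδ, hcl⟩ := hcl ρ hρ0
  have hrate := S.rate_pos
  refine ⟨min δ (S.rate * ρ ^ 2), by positivity, fun x hx => ?_⟩
  have hmono := S.antitone_energy x
  have hstep : ∀ n, S.energy x - S.energy (S.map^[n + 1] x) < min δ (S.rate * ρ ^ 2) →
      dist (S.map^[n + 1] x) (S.map^[n] x) < ρ := by
    intro n hn
    have h1 := S.descent (S.map^[n] x)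
    rw [← Function.iterate_succ_apply' S.map] at h1
    have h2 : S.energy (S.map^[n] x) ≤ S.energy x := hmono (Nat.zero_le n)
    have h3 : S.rate * dist (S.map^[n + 1] x) (S.map^[n] x) ^ 2 < S.rate * ρ ^ 2 := by
      linarith [min_le_right δ (S.rate * ρ ^ 2)]
    exact lt_of_pow_lt_pow_left₀ 2 hρ0.le (lt_of_mul_lt_mul_left h3 hrate.le)
  have hlow : ∀ n, S.energy x - S.energy (S.map^[n + 1] x) < min δ (S.rate * ρ ^ 2) →
      S.energy (S.map^[n] x) - S.energy (S.map (S.map^[n] x)) ≤ δ := by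
    intro n hn
    rw [← Function.iterate_succ_apply' S.map]
    have h2 : S.energy (S.map^[n] x) ≤ S.energy x := hmono (Nat.zero_le n)
    linarith [min_le_left δ (S.rate * ρ ^ 2)]
  -- The bound is on the energy at time `n + 1`, because the point at time `n` is almost stationary
  -- only if its next step loses little. The last step then costs a further ρ, within r.
  have key : ∀ n, S.energy x - S.energy (S.map^[n + 1] x) < min δ (S.rate * ρ ^ 2) →
      dist (S.map^[n] x) x < ρ := by
    intro n
    induction n with
    | zero => intro _; simpa using hρ0
    | succ n ih =>
      intro hn
      have hn' : S.energy x - S.energy (S.map^[n + 1] x) < min δ (S.rate * ρ ^ 2) := by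
        linarith [S.energy_iterate_succ_le x (n + 1)]
      have hn0 : S.energy x - S.energy (S.map^[0 + 1] x) < min δ (S.rate * ρ ^ 2) := by
        have : S.energy (S.map^[n + 1] x) ≤ S.energy (S.map^[0 + 1] x) := hmono (by omega)
        linarith
      have h1 : dist (S.map^[n + 1] x) x < κ := by
        linarith [dist_triangle (S.map^[n + 1] x) (S.map^[n] x) x, ih hn', hstep n hn']
      rcases hcl (S.map^[n + 1] x) x ((hmono (Nat.zero_le (n + 1))).trans hx) hx (hlow _ hn)
        (hlow 0 hn0) with h | h
      · exact h
      · linarith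
  rintro (_ | n) hn
  · simpa using hr
  · linarith [dist_triangle (S.map^[n + 1] x) (S.map^[n] x) x, key n hn, hstep n hn]

/-- Every trajectory converges to a fixed point. -/
theorem exists_tendsto_iterate [CompleteSpace X] (x : X) :
    ∃ y, S.map y = y ∧ Tendsto (fun n => S.map^[n] x) atTop (𝓝 y) := by
  have hbdd : BddBelow (range fun n => S.energy (S.map^[n] x)) :=
    ⟨0, by rintro _ ⟨n, rfl⟩; exact S.energy_nonneg _⟩
  have hlim := tendsto_atTop_ciInf (S.antitone_energy x) hbdd
  have hge := fun n => ciInf_le hbdd n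
  set ℓ := ⨅ n, S.energy (S.map^[n] x)
  have hC : CauchySeq fun n => S.map^[n] x := by
    rw [Metric.cauchySeq_iff']
    intro r hr
    obtain ⟨ε, hε, hQ⟩ := S.exists_dist_iterate_lt (S.energy x) hr
    obtain ⟨N, hN⟩ := (hlim.eventually (gt_mem_nhds (lt_add_of_pos_right ℓ hε))).exists
    refine ⟨N, fun n hn => ?_⟩
    obtain ⟨k, rfl⟩ := Nat.exists_eq_add_of_le' hn
    rw [Function.iterate_add_apply]
    refine hQ _ (S.antitone_energy x (Nat.zero_le N)) k ?_
    rw [← Function.iterate_add_apply]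
    linarith [hge (k + N)]
  obtain ⟨y, hy⟩ := cauchySeq_tendsto_of_complete hC
  exact ⟨y, isFixedPt_of_tendsto_iterate hy S.continuous_map.continuousAt, hy⟩

/-- Fixed points in a sublevel set are uniformly separated. -/
theorem exists_fixed_separated (D : ℝ) : ∃ κ : ℝ, 0 < κ ∧ ∀ x y, S.map x = x → S.map y = y →
    S.energy x ≤ D → S.energy y ≤ D → x ≠ y → κ ≤ dist x y := by
  obtain ⟨κ, hκ, hcl⟩ := S.clusters D
  refine ⟨κ, hκ, fun x y hx hy hxD hyD hne => ?_⟩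
  obtain ⟨δ, hδ, h⟩ := hcl (dist x y) (dist_pos.2 hne)
  rcases h x y hxD hyD (by rw [hx, sub_self]; exact hδ.le) (by rw [hy, sub_self]; exact hδ.le)
    with h | h
  · exact absurd h (lt_irrefl _)
  · exact h

/-- The trajectories of a compact set enter any neighbourhood of the fixed points at the top
critical level `c`, or the sublevel set below `c`, after finitely many steps. -/
theorem exists_iterate_mem [CompleteSpace X] {A : Set X} (hA : IsCompact A) {c r : ℝ} (hr : 0 < r)
    (hc : ∀ y, S.map y = y → (∃ x ∈ A, S.energy y ≤ S.energy x) → S.energy y ≤ c) :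
    ∃ n, ∀ x ∈ A, S.energy (S.map^[n] x) < c ∨
      ∃ y, S.map y = y ∧ S.energy y = c ∧ dist (S.map^[n] x) y < r := by
  -- Requiring the conclusion for all later times makes it stable under finite unions, as induction
  -- over the compact set demands.
  suffices h : ∃ n, ∀ x ∈ A, ∀ m ≥ n, S.energy (S.map^[m] x) < c ∨
      ∃ y, S.map y = y ∧ S.energy y = c ∧ dist (S.map^[m] x) y < r by
    obtain ⟨n, hn⟩ := h
    exact ⟨n, fun x hx => hn x hx n le_rfl⟩
  refine hA.induction_on (p := fun s => ∃ n, ∀ x ∈ s, ∀ m ≥ n, S.energy (S.map^[m] x) < c ∨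
      ∃ y, S.map y = y ∧ S.energy y = c ∧ dist (S.map^[m] x) y < r) ⟨0, by simp⟩ ?_ ?_ ?_
  · rintro s t hst ⟨n, hn⟩
    exact ⟨n, fun x hx => hn x (hst hx)⟩
  · rintro s t ⟨n, hn⟩ ⟨k, hk⟩
    refine ⟨max n k, fun x hx m hm => ?_⟩
    rcases hx with hx | hx
    · exact hn x hx m ((le_max_left _ _).trans hm)
    · exact hk x hx m ((le_max_right _ _).trans hm)
  · intro x hx
    obtain ⟨y, hy, hlim⟩ := S.exists_tendsto_iterate x
    have hE : Tendsto (fun n => S.energy (S.map^[n] x)) atTop (𝓝 (S.energy y)) :=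
      (S.continuous_energy.tendsto y).comp hlim
    have hyx : S.energy y ≤ S.energy x :=
      le_of_tendsto' hE fun n => S.antitone_energy x (Nat.zero_le n)
    rcases (hc y hy ⟨x, hx, hyx⟩).lt_or_eq with hlt | heq
    · obtain ⟨n, hn⟩ := (hE.eventually (gt_mem_nhds hlt)).exists
      refine ⟨{z | S.energy (S.map^[n] z) < c}, mem_nhdsWithin_of_mem_nhds
        ((isOpen_lt (S.continuous_energy.comp (S.continuous_iterate n)) continuous_const).mem_nhds
          hn), n, fun z hz m hm => Or.inl ((S.antitone_energy z hm).trans_lt hz)⟩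
    -- A nearby trajectory enters with energy below c + ε; while its energy stays at least c it has
    -- lost less than ε, so it remains near `y`.
    · obtain ⟨ε, hε, hQ⟩ := S.exists_dist_iterate_lt (c + 1) (half_pos hr)
      have hε' : 0 < min ε 1 := by positivity
      obtain ⟨n, hn1, hn2⟩ := ((hE.eventually (gt_mem_nhds
        (heq ▸ lt_add_of_pos_right _ hε' : S.energy y < c + min ε 1))).and
        (hlim.eventually (Metric.ball_mem_nhds y (half_pos hr)))).exists
      have hcont := S.continuous_iterate n
      refine ⟨{z | S.energy (S.map^[n] z) < c + min ε 1 ∧ dist (S.map^[n] z) y < r / 2},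
        mem_nhdsWithin_of_mem_nhds (((isOpen_lt (S.continuous_energy.comp hcont)
          continuous_const).inter (isOpen_lt (hcont.dist continuous_const)
            continuous_const)).mem_nhds ⟨hn1, hn2⟩), n, ?_⟩
      rintro z ⟨hz1, hz2⟩ m hm
      by_cases hzc : S.energy (S.map^[m] z) < c
      · exact Or.inl hzc
      · refine Or.inr ⟨y, hy, heq, ?_⟩
        obtain ⟨k, rfl⟩ := Nat.exists_eq_add_of_le' hm
        rw [Function.iterate_add_apply] at hzc ⊢
        have := hQ (S.map^[n] z) (by linarith [min_le_right ε 1]) k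
          (by linarith [min_le_left ε 1])
        linarith [dist_triangle (S.map^[k] (S.map^[n] z)) (S.map^[n] z) y]

open Classical in
/-- A compact symmetric set has genus at most the number of critical values not above it. -/
theorem genusLE [CompleteSpace X] (hfree : ∀ x : X, -x ≠ x) (V : Finset ℝ)
    (hV : ∀ y, S.map y = y → S.energy y ∈ V) (n : ℕ) : ∀ A : Set X, IsCompact A →
      (∀ x ∈ A, -x ∈ A) → (V.filter fun c => ∃ x ∈ A, c ≤ S.energy x).card ≤ n →
      GenusLE A n := by
  induction n with
  | zero =>
    intro A hA hneg hcard
    have hemp : ∀ x ∈ A, False := by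
      intro x hx
      obtain ⟨y, hy, hlim⟩ := S.exists_tendsto_iterate x
      have hE : Tendsto (fun n => S.energy (S.map^[n] x)) atTop (𝓝 (S.energy y)) :=
        (S.continuous_energy.tendsto y).comp hlim
      have hyx : S.energy y ≤ S.energy x :=
        le_of_tendsto' hE fun n => S.antitone_energy x (Nat.zero_le n)
      have h0 := Finset.card_eq_zero.1 (Nat.le_zero.1 hcard)
      have : S.energy y ∈ V.filter fun c => ∃ x ∈ A, c ≤ S.energy x :=
        Finset.mem_filter.2 ⟨hV y hy, x, hx, hyx⟩
      rw [h0] at this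
      exact absurd this (Finset.notMem_empty _)
    exact ⟨fun _ => ∅, fun i hi => absurd hi (Nat.not_lt_zero i), fun x hx => (hemp x hx).elim⟩
  | succ n ih =>
    intro A hA hneg hcard
    set W := V.filter fun c => ∃ x ∈ A, c ≤ S.energy x with hW
    rcases W.eq_empty_or_nonempty with hemp | hne
    · obtain ⟨C, hC, hcov⟩ := ih A hA hneg (by rw [← hW, hemp]; simp)
      refine ⟨fun i => if i < n then C i else ∅, fun i hi => ?_, fun x hx => ?_⟩
      · by_cases h : i < n
        · simpa [h] using hC i h
        · simp [h]
      · obtain ⟨i, hi, h⟩ := hcov x hx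
        exact ⟨i, by omega, by simpa [hi] using h⟩
    set c := W.max' hne with hcdef
    have hcW : c ∈ W := W.max'_mem hne
    -- With `c` the top relevant critical value, flow until every point is below `c` or near a fixed
    -- point at level `c`. Off a neighbourhood of these fixed points `c` no longer counts and
    -- induction applies; the neighbourhood costs one further antipodal pair.
    obtain ⟨κ, hκ, hsep⟩ := S.exists_fixed_separated c
    obtain ⟨N, hN⟩ := S.exists_iterate_mem hA (c := c) (r := κ / 4) (by positivity) (by
      rintro y hy ⟨x, hx, hyx⟩
      exact W.le_max' _ (Finset.mem_filter.2 ⟨hV y hy, x, hx, hyx⟩))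
    refine GenusLE.comap (S.continuous_iterate N) (fun x => S.iterate_neg x N) hA hneg ?_
    set B := S.map^[N] '' A with hB
    have hBc : IsCompact B := hA.image (S.continuous_iterate N)
    have hBneg : ∀ x ∈ B, -x ∈ B := by
      rintro _ ⟨x, hx, rfl⟩
      exact ⟨-x, hneg x hx, S.iterate_neg x N⟩
    set K : Set X := {y | S.map y = y ∧ S.energy y = c} with hK
    have hKneg : ∀ y ∈ K, -y ∈ K := by
      rintro y ⟨h1, h2⟩
      exact ⟨by rw [S.map_neg, h1], by rw [S.energy_neg, h2]⟩
    set U : Set X := Metric.thickening (κ / 4) K with hU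
    have hUneg : ∀ x, -x ∈ U → x ∈ U := by
      intro x hx
      obtain ⟨y, hy, hxy⟩ := Metric.mem_thickening_iff.1 hx
      refine Metric.mem_thickening_iff.2 ⟨-y, hKneg y hy, ?_⟩
      rwa [← S.dist_neg, neg_neg]
    obtain ⟨C, hC, hcov⟩ := ih (B \ U) (hBc.diff Metric.isOpen_thickening)
      (fun x hx => ⟨hBneg x hx.1, fun h => hx.2 (hUneg x h)⟩) (by
        have hlt : (V.filter fun a => ∃ x ∈ B \ U, a ≤ S.energy x) ⊂ W := by
          refine (Finset.ssubset_iff_of_subset fun a ha => ?_).2 ⟨c, hcW, fun hc' => ?_⟩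
          · obtain ⟨haV, _, ⟨⟨x, hx, rfl⟩, -⟩, hax⟩ := Finset.mem_filter.1 ha
            exact Finset.mem_filter.2
              ⟨haV, x, hx, hax.trans (S.antitone_energy x (Nat.zero_le N))⟩
          · obtain ⟨-, _, ⟨⟨x, hx, rfl⟩, hxU⟩, hax⟩ := Finset.mem_filter.1 hc'
            rcases hN x hx with h | ⟨y, hy1, hy2, hy3⟩
            · linarith
            · exact hxU (Metric.mem_thickening_iff.2 ⟨y, ⟨hy1, hy2⟩, hy3⟩)
        have := Finset.card_lt_card hlt
        omega)
    -- One point from each antipodal pair of `K`. If `x` and `-x` both lay in the closed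
    -- κ/4-neighbourhood of `P`, a point of `P` and the antipode of a point of `P` would be distinct
    -- fixed points less than κ apart.
    set P : Set X := {y | y ∈ K ∧ WellOrderingRel y (-y)} with hP
    have hPK : ∀ y ∈ K, y ∈ P ∨ -y ∈ P := by
      intro y hy
      rcases trichotomous_of WellOrderingRel y (-y) with h | h | h
      · exact Or.inl ⟨hy, h⟩
      · exact absurd h.symm (hfree y)
      · exact Or.inr ⟨hKneg y hy, by rwa [neg_neg]⟩
    refine ⟨fun i => if i < n then C i else B ∩ Metric.cthickening (κ / 4) P, fun i hi => ?_,
      fun x hx => ?_⟩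
    · by_cases h : i < n
      · simpa [h] using hC i h
      · simp only [h, if_false]
        refine ⟨hBc.inter_right Metric.isClosed_cthickening, fun x hx hx' => ?_⟩
        have hsub := Metric.cthickening_subset_thickening' (δ₁ := κ / 4) (δ₂ := κ / 2)
          (by positivity) (by linarith) P
        obtain ⟨y, hy, hxy⟩ := Metric.mem_thickening_iff.1 (hsub hx.2)
        obtain ⟨z, hz, hxz⟩ := Metric.mem_thickening_iff.1 (hsub hx'.2)
        rw [← S.dist_neg, neg_neg] at hxz
        have hyz : y ≠ -z := by
          rintro rfl
          have h1 := hy.2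
          rw [neg_neg] at h1
          exact asymm_of WellOrderingRel h1 hz.2
        have h1 := hsep y (-z) hy.1.1 (hKneg z hz.1).1 hy.1.2.le (hKneg z hz.1).2.le hyz
        have h2 := dist_triangle_left y (-z) x
        linarith
    · by_cases hxU : x ∈ U
      · refine ⟨n, Nat.lt_succ_self n, ?_⟩
        simp only [lt_irrefl, if_false]
        obtain ⟨y, hy, hxy⟩ := Metric.mem_thickening_iff.1 hxU
        have hsub := Metric.thickening_subset_cthickening (κ / 4) P
        rcases hPK y hy with h | h
        · exact Or.inl ⟨hx, hsub (Metric.mem_thickening_iff.2 ⟨y, h, hxy⟩)⟩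
        · exact Or.inr ⟨hBneg x hx, hsub (Metric.mem_thickening_iff.2
            ⟨-y, h, by rwa [S.dist_neg]⟩)⟩
      · obtain ⟨i, hi, h⟩ := hcov x ⟨hx, hxU⟩
        exact ⟨i, by omega, by simpa [hi] using h⟩

end DescentSystem

end Descent

/-! ### The discrete fractional Laplacian as an operator on `ℓ²` -/

section Fourier

variable {d : ℕ}

instance instIsFiniteMeasureCube : IsFiniteMeasure (cubeMeasure d) :=
  ⟨by
    rw [Measure.restrict_apply_univ]
    exact isCompact_Icc.measure_lt_top⟩

theorem conj_character_mul_character (x y : Lattice d) (θ : Fin d → ℝ) :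
    (starRingEnd ℂ) (character x θ) * character y θ = character (y - x) θ := by
  have hp : pairing (y - x) θ = -pairing x θ + pairing y θ := by
    simp only [pairing, Pi.sub_apply, Int.cast_sub, sub_mul, Finset.sum_sub_distrib]; ring
  simp only [character]
  rw [← Complex.exp_conj, ← Complex.exp_add, hp]
  congr 1
  simp only [map_mul, Complex.conj_I, Complex.conj_ofReal]
  push_cast
  ring

theorem integral_exp_int_mul (n : ℤ) :
    ∫ t in Icc (-Real.pi) Real.pi, Complex.exp (Complex.I * ((n : ℝ) * t : ℝ)) =
      if n = 0 then (2 * Real.pi : ℂ) else 0 := by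
  rw [integral_Icc_eq_integral_Ioc, ← intervalIntegral.integral_of_le (by linarith [Real.pi_pos])]
  split_ifs with h
  · subst h
    simp
    ring
  · have hc : (Complex.I * n : ℂ) ≠ 0 :=
      mul_ne_zero Complex.I_ne_zero (by exact_mod_cast h)
    have : ∀ t : ℝ, Complex.exp (Complex.I * ((n : ℝ) * t : ℝ)) =
        Complex.exp ((Complex.I * n) * t) := by
      intro t; congr 1; push_cast; ring
    simp only [this]
    rw [integral_exp_mul_complex hc, div_eq_zero_iff]
    left
    rw [sub_eq_zero, Complex.exp_eq_exp_iff_exists_int]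
    refine ⟨n, ?_⟩
    push_cast
    ring

theorem integral_character (x : Lattice d) :
    ∫ θ in cube d, character x θ = if x = 0 then (2 * Real.pi : ℂ) ^ d else 0 := by
  have h1 : cubeMeasure d = Measure.pi fun _ : Fin d => volume.restrict (Icc (-Real.pi) Real.pi) := by
    rw [← Measure.restrict_pi_pi, pi_univ_Icc]; rfl
  have h2 : ∀ θ, character x θ = ∏ i, Complex.exp (Complex.I * ((x i : ℝ) * θ i : ℝ)) := by
    intro θ
    rw [character, ← Complex.exp_sum, pairing]
    push_cast
    rw [Finset.mul_sum]
  simp only [h2]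
  rw [show volume.restrict (cube d) = _ from h1, integral_fintype_prod_eq_prod (𝕜 := ℂ)
    (f := fun i t => Complex.exp (Complex.I * ((x i : ℝ) * t : ℝ)))]
  simp only [integral_exp_int_mul]
  split_ifs with h
  · subst h; simp
  · obtain ⟨i, hi⟩ := Function.ne_iff.1 h
    exact Finset.prod_eq_zero (Finset.mem_univ i) (if_neg hi)

/-- The exponentials `e^{i x·θ}` as elements of `L²`. -/
noncomputable def mode (x : Lattice d) : Lp ℂ 2 (cubeMeasure d) := (memLp_character x).toLp (character x)

theorem coeFn_mode (x : Lattice d) : mode x =ᵐ[cubeMeasure d] character x :=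
  MemLp.coeFn_toLp _

theorem inner_mode_mode (x y : Lattice d) :
    inner ℂ (mode x) (mode y) = if x = y then (2 * Real.pi : ℂ) ^ d else 0 := by
  rw [L2.inner_def]
  have : ∫ θ, inner ℂ (mode x θ) (mode y θ) ∂(cubeMeasure d) = ∫ θ in cube d, character (y - x) θ := by
    refine integral_congr_ae ?_
    filter_upwards [coeFn_mode x, coeFn_mode y] with θ h1 h2
    rw [h1, h2, ← conj_character_mul_character, RCLike.inner_apply, mul_comm]
  rw [this, integral_character]
  simp only [sub_eq_zero, eq_comm]

/-- The normalizing factor `(2π)^{d/2}`. -/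
noncomputable def modeNorm (d : ℕ) : ℝ := Real.sqrt ((2 * Real.pi) ^ d)

theorem modeNorm_pos : 0 < modeNorm d := Real.sqrt_pos.2 (by positivity)

theorem modeNorm_sq : ((modeNorm d : ℝ) : ℂ) * modeNorm d = (2 * Real.pi : ℂ) ^ d := by
  have : modeNorm d * modeNorm d = (2 * Real.pi) ^ d := Real.mul_self_sqrt (by positivity)
  exact_mod_cast this

/-- The normalized exponentials. -/
noncomputable def unitMode (x : Lattice d) : Lp ℂ 2 (cubeMeasure d) :=
  ((modeNorm d : ℝ) : ℂ)⁻¹ • mode x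

theorem modeNorm_ne_zero : ((modeNorm d : ℝ) : ℂ) ≠ 0 :=
  Complex.ofReal_ne_zero.2 modeNorm_pos.ne'

theorem orthonormal_unitMode : Orthonormal ℂ (unitMode (d := d)) := by
  classical
  rw [orthonormal_iff_ite]
  intro x y
  rw [unitMode, unitMode, inner_smul_left, inner_smul_right, inner_mode_mode]
  split_ifs
  · rw [← modeNorm_sq, map_inv₀, Complex.conj_ofReal]
    field_simp [modeNorm_ne_zero (d := d)]
  · simp

/-! ### The Fourier transform as an isometry -/

/-- The complex sequence space `ℓ²(ℤ^d)`. -/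
abbrev CEll2 (d : ℕ) : Type := lp (fun _ : Lattice d => ℂ) 2

/-- The unitary Fourier transform on complex sequences. -/
noncomputable def unitFourier (d : ℕ) : CEll2 d →ₗᵢ[ℂ] Lp ℂ 2 (cubeMeasure d) :=
  (orthonormal_unitMode (d := d)).orthogonalFamily.linearIsometry

theorem unitFourier_single [DecidableEq (Lattice d)] (x : Lattice d) :
    unitFourier d (lp.single 2 x (1 : ℂ)) = unitMode x := by
  have h := OrthogonalFamily.linearIsometry_apply_single
    (orthonormal_unitMode (d := d)).orthogonalFamily (i := x) (1 : ℂ)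
  rw [LinearIsometry.toSpanSingleton_apply, one_smul] at h
  exact h

/-- The inclusion of real sequences into complex sequences. -/
noncomputable def complexify (d : ℕ) : Ell2 d →L[ℝ] CEll2 d :=
  LinearMap.mkContinuous
    { toFun := fun u => ⟨fun x => ((u x : ℝ) : ℂ), (lp.memℓp u).mono' fun x => by simp⟩
      map_add' := fun u v => by ext x; simp; rfl
      map_smul' := fun a u => by ext x; simp } 1 fun u => by
    rw [one_mul]
    exact lp.norm_mono (by norm_num) fun x => by simp

@[simp] theorem complexify_apply (u : Ell2 d) (x : Lattice d) : complexify d u x = (u x : ℂ) := rfl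

/-- The real part of a complex sequence. -/
noncomputable def rePart (d : ℕ) : CEll2 d →L[ℝ] Ell2 d :=
  LinearMap.mkContinuous
    { toFun := fun u => ⟨fun x => (u x).re, (lp.memℓp u).mono' fun x => Complex.abs_re_le_norm _⟩
      map_add' := fun u v => by ext x; simp; rfl
      map_smul' := fun a u => by ext x; simp } 1 fun u => by
    rw [one_mul]
    exact lp.norm_mono (by norm_num) fun x => Complex.abs_re_le_norm _

@[simp] theorem rePart_apply (u : CEll2 d) (x : Lattice d) : rePart d u x = (u x).re := rfl

theorem inner_rePart (a : CEll2 d) (w : Ell2 d) :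
    inner ℝ (rePart d a) w = (inner ℂ a (complexify d w)).re := by
  refine (lp.hasSum_inner (𝕜 := ℝ) (rePart d a) w).unique ?_
  convert! Complex.hasSum_re (lp.hasSum_inner (𝕜 := ℂ) a (complexify d w)) using 2 with x
  simp [RCLike.inner_apply]

theorem hasSum_fourier (u : Ell2 d) :
    HasSum (fun x => (u x : ℂ) • mode x) ((modeNorm d : ℂ) • unitFourier d (complexify d u)) := by
  have h := (OrthogonalFamily.hasSum_linearIsometry
    (orthonormal_unitMode (d := d)).orthogonalFamily (complexify d u)).const_smul (modeNorm d : ℂ)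
  have hfun : (fun x => (u x : ℂ) • mode x) = fun x => (modeNorm d : ℂ) •
      LinearIsometry.toSpanSingleton ℂ (Lp ℂ 2 (cubeMeasure d)) (orthonormal_unitMode.1 x)
        (complexify d u x) := by
    funext x
    rw [LinearIsometry.toSpanSingleton_apply, complexify_apply, unitMode, smul_smul, smul_smul,
      mul_right_comm, mul_inv_cancel₀ modeNorm_ne_zero, one_mul]
  rw [hfun]
  exact h

theorem fourier_eq (u : Ell2 d) :
    fourier u = (modeNorm d : ℂ) • unitFourier d (complexify d u) :=
  (hasSum_fourier u).tsum_eq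

/-! ### Multiplication by the symbol -/

theorem symbol_nonneg (θ : Fin d → ℝ) : 0 ≤ symbol θ :=
  Finset.sum_nonneg fun i _ => by positivity

theorem symbol_le (θ : Fin d → ℝ) : symbol θ ≤ 4 * d := by
  have : symbol θ ≤ ∑ _i : Fin d, (4 : ℝ) :=
    Finset.sum_le_sum fun i _ => by nlinarith [Real.sin_sq_le_one (θ i / 2)]
  simpa [mul_comm] using this

theorem symbol_neg (θ : Fin d → ℝ) : symbol (-θ) = symbol θ := by
  simp [symbol, neg_div]

theorem measurable_symbol_rpow (α : ℝ) : Measurable fun θ : Fin d → ℝ => symbol θ ^ α := by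
  have : Measurable fun θ : Fin d → ℝ => symbol θ := by unfold symbol; fun_prop
  exact this.pow_const α

theorem symbol_rpow_le {α : ℝ} (hα : 0 ≤ α) (θ : Fin d → ℝ) : symbol θ ^ α ≤ (4 * d) ^ α :=
  Real.rpow_le_rpow (symbol_nonneg θ) (symbol_le θ) hα

theorem memLp_symbol {α : ℝ} (hα : 0 ≤ α) :
    MemLp (fun θ => ((symbol θ ^ α : ℝ) : ℂ)) ⊤ (cubeMeasure d) := by
  refine memLp_top_of_bound
    (Complex.measurable_ofReal.comp (measurable_symbol_rpow α)).aestronglyMeasurable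
    ((4 * d) ^ α) (Filter.Eventually.of_forall fun θ => ?_)
  rw [Complex.norm_real, Real.norm_of_nonneg (Real.rpow_nonneg (symbol_nonneg θ) α)]
  exact symbol_rpow_le hα θ

/-- Multiplication by `Φ^α` on `L²`. -/
noncomputable def multiplier {α : ℝ} (hα : 0 ≤ α) :
    Lp ℂ 2 (cubeMeasure d) →L[ℂ] Lp ℂ 2 (cubeMeasure d) :=
  (ContinuousLinearMap.lsmul ℂ ℂ).holderL (cubeMeasure d) ⊤ 2 2 (memLp_symbol hα).toLp

theorem coeFn_multiplier {α : ℝ} (hα : 0 ≤ α) (v : Lp ℂ 2 (cubeMeasure d)) :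
    multiplier hα v =ᵐ[cubeMeasure d] fun θ => ((symbol θ ^ α : ℝ) : ℂ) * v θ := by
  have h1 := (ContinuousLinearMap.lsmul ℂ ℂ).coeFn_holder (r := 2) (memLp_symbol (d := d) hα).toLp v
  filter_upwards [h1, (memLp_symbol (d := d) hα).coeFn_toLp] with θ h1 h2
  rw [h2] at h1
  exact h1

theorem inner_multiplier {α : ℝ} (hα : 0 ≤ α) (v w : Lp ℂ 2 (cubeMeasure d)) :
    inner ℂ v (multiplier hα w) =
      ∫ θ in cube d, ((symbol θ ^ α : ℝ) : ℂ) * (w θ * (starRingEnd ℂ) (v θ)) := by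
  rw [L2.inner_def]
  refine integral_congr_ae ?_
  filter_upwards [coeFn_multiplier hα w] with θ h
  rw [h, RCLike.inner_apply, mul_assoc]

theorem inner_multiplier_left {α : ℝ} (hα : 0 ≤ α) (v w : Lp ℂ 2 (cubeMeasure d)) :
    inner ℂ (multiplier hα v) w = inner ℂ v (multiplier hα w) := by
  rw [L2.inner_def, L2.inner_def]
  refine integral_congr_ae ?_
  filter_upwards [coeFn_multiplier hα w, coeFn_multiplier hα v] with θ h h'
  rw [h, h', RCLike.inner_apply, RCLike.inner_apply, map_mul]
  simp only [Complex.conj_ofReal]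
  ring

theorem re_inner_multiplier_self {α : ℝ} (hα : 0 ≤ α) (v : Lp ℂ 2 (cubeMeasure d)) :
    0 ≤ (inner ℂ v (multiplier hα v)).re := by
  have : inner ℂ v (multiplier hα v) =
      ((∫ θ in cube d, symbol θ ^ α * ‖v θ‖ ^ 2 : ℝ) : ℂ) := by
    rw [inner_multiplier, ← integral_complex_ofReal]
    refine integral_congr_ae (Filter.Eventually.of_forall fun θ => ?_)
    simp only [Complex.mul_conj, Complex.normSq_eq_norm_sq]
    push_cast
    rfl
  rw [this, Complex.ofReal_re]
  exact integral_nonneg fun θ =>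
    mul_nonneg (Real.rpow_nonneg (symbol_nonneg θ) α) (sq_nonneg _)

/-- The fractional Laplacian on complex sequences. -/
noncomputable def complexLaplacian {α : ℝ} (hα : 0 ≤ α) : CEll2 d →L[ℂ] CEll2 d :=
  (ContinuousLinearMap.adjoint (unitFourier d).toContinuousLinearMap) ∘L (multiplier hα) ∘L
    (unitFourier d).toContinuousLinearMap

theorem inner_complexLaplacian {α : ℝ} (hα : 0 ≤ α) (u w : CEll2 d) :
    inner ℂ w (complexLaplacian hα u) =
      inner ℂ (unitFourier d w) (multiplier hα (unitFourier d u)) := by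
  simp only [complexLaplacian, ContinuousLinearMap.comp_apply,
    ContinuousLinearMap.adjoint_inner_right, LinearIsometry.coe_toContinuousLinearMap]

theorem complexLaplacian_apply {α : ℝ} (hα : 0 ≤ α) (u : CEll2 d) (x : Lattice d) :
    complexLaplacian hα u x = inner ℂ (unitMode x) (multiplier hα (unitFourier d u)) := by
  classical
  have h := lp.inner_single_left (𝕜 := ℂ) x (1 : ℂ) (complexLaplacian hα u)
  rw [inner_complexLaplacian, unitFourier_single] at h
  rw [h]
  simp

/-- Two factors (2π)^{-d/2}, one from normalizing the transform and one from the unit exponential,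
combine to the (2π)^{-d} of the inversion formula. -/
theorem fracLaplacian_eq {α : ℝ} (hα : 0 ≤ α) (u : Ell2 d) (x : Lattice d) :
    fracLaplacian α u x = complexLaplacian hα (complexify d u) x := by
  have h1 : multiplier hα (unitFourier d (complexify d u)) =
      (modeNorm d : ℂ)⁻¹ • multiplier hα (fourier u) := by
    rw [fourier_eq, map_smul, smul_smul, inv_mul_cancel₀ modeNorm_ne_zero, one_smul]
  rw [complexLaplacian_apply, h1, unitMode, inner_smul_left, inner_smul_right, ← mul_assoc,
    map_inv₀, Complex.conj_ofReal, ← mul_inv, modeNorm_sq, fracLaplacian, fourierInv, one_div,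
    inner_multiplier]
  congr 1
  refine integral_congr_ae ?_
  filter_upwards [coeFn_mode x] with θ h
  rw [h, mul_assoc, character, ← Complex.exp_conj]
  congr 3
  simp

/-! ### Convolution form and reality of the fractional Laplacian -/

/-- The convolution kernel of the fractional Laplacian. -/
noncomputable def kernel (d : ℕ) (α : ℝ) (x : Lattice d) : ℝ :=
  (((2 * Real.pi : ℂ) ^ d)⁻¹ * ∫ θ in cube d, ((symbol θ ^ α : ℝ) : ℂ) * character x θ).re

/-- Conjugation amounts to θ ↦ -θ, which preserves both the symbol and the cube. Thus the kernel is
real and the operator preserves real sequences. -/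
theorem integral_symbol_character_conj (α : ℝ) (x : Lattice d) :
    (starRingEnd ℂ) (∫ θ in cube d, ((symbol θ ^ α : ℝ) : ℂ) * character x θ) =
      ∫ θ in cube d, ((symbol θ ^ α : ℝ) : ℂ) * character x θ := by
  rw [← integral_conj]
  have hpre : (fun θ : Fin d → ℝ => -θ) ⁻¹' cube d = cube d := by
    ext θ
    simp only [cube, mem_preimage, mem_Icc, Pi.le_def, Pi.neg_apply]
    constructor <;> rintro ⟨h1, h2⟩ <;> constructor <;> intro i <;>
      linarith [h1 i, h2 i]
  have hmp : MeasurePreserving (fun θ : Fin d → ℝ => -θ) (volume.restrict (cube d))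
      (volume.restrict (cube d)) := by
    have := (Measure.measurePreserving_neg (volume : Measure (Fin d → ℝ))).restrict_preimage
      (s := cube d) measurableSet_Icc
    rwa [show Neg.neg ⁻¹' cube d = cube d from hpre] at this
  rw [← hmp.integral_comp (MeasurableEquiv.neg _).measurableEmbedding]
  refine integral_congr_ae (Filter.Eventually.of_forall fun θ => ?_)
  simp only [map_mul, Complex.conj_ofReal, symbol_neg]
  congr 1
  rw [character, character, ← Complex.exp_conj]
  congr 1
  simp [pairing]

theorem complexLaplacian_single [DecidableEq (Lattice d)] {α : ℝ} (hα : 0 ≤ α)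
    (x y : Lattice d) :
    complexLaplacian hα (lp.single 2 y (1 : ℂ)) x = (kernel d α (y - x) : ℂ) := by
  rw [complexLaplacian_apply, unitFourier_single, unitMode, unitMode, map_smul, inner_smul_left,
    inner_smul_right, ← mul_assoc, map_inv₀, Complex.conj_ofReal, ← mul_inv, modeNorm_sq,
    inner_multiplier]
  have h1 : ∫ θ in cube d, ((symbol θ ^ α : ℝ) : ℂ) * (mode y θ * (starRingEnd ℂ) (mode x θ)) =
      ∫ θ in cube d, ((symbol θ ^ α : ℝ) : ℂ) * character (y - x) θ := by
    refine integral_congr_ae ?_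
    filter_upwards [coeFn_mode x, coeFn_mode y] with θ h h'
    rw [h, h', mul_comm (character y θ), conj_character_mul_character]
  rw [h1, kernel]
  refine (Complex.conj_eq_iff_re.1 ?_).symm
  have h2 : ((2 * Real.pi : ℂ) ^ d)⁻¹ = ((((2 * Real.pi) ^ d)⁻¹ : ℝ) : ℂ) := by push_cast; rfl
  rw [map_mul, integral_symbol_character_conj, h2, Complex.conj_ofReal]

/-- A continuous operator may be applied termwise to the expansion in point masses. Both reality and
translation invariance are read off from this convolution. -/
theorem hasSum_complexLaplacian {α : ℝ} (hα : 0 ≤ α) (u : Ell2 d) (x : Lattice d) :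
    HasSum (fun y => ((u y * kernel d α (y - x) : ℝ) : ℂ))
      (complexLaplacian hα (complexify d u) x) := by
  classical
  have h1 := lp.hasSum_single (E := fun _ : Lattice d => ℂ) (p := 2) (by norm_num) (complexify d u)
  have h2 := (h1.mapL (complexLaplacian hα)).mapL (innerSL ℂ (lp.single 2 x (1 : ℂ)))
  have h3 : ∀ v : CEll2 d, innerSL ℂ (lp.single 2 x (1 : ℂ) : CEll2 d) v = v x := by
    intro v
    rw [innerSL_apply_apply, lp.inner_single_left]
    simp
  rw [h3] at h2
  refine h2.congr_fun fun y => ?_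
  have h4 : (lp.single 2 y (complexify d u y) : CEll2 d) =
      (u y : ℂ) • lp.single 2 y (1 : ℂ) := by
    rw [← lp.single_smul]; simp
  rw [h3, h4, map_smul, lp.coeFn_smul, Pi.smul_apply, complexLaplacian_single]
  simp

/-- The fractional Laplacian on real sequences. -/
noncomputable def laplacian {α : ℝ} (hα : 0 ≤ α) : Ell2 d →L[ℝ] Ell2 d :=
  rePart d ∘L (complexLaplacian hα).restrictScalars ℝ ∘L complexify d

theorem hasSum_laplacian {α : ℝ} (hα : 0 ≤ α) (u : Ell2 d) (x : Lattice d) :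
    HasSum (fun y => u y * kernel d α (y - x)) (laplacian hα u x) := by
  have h := Complex.hasSum_re (hasSum_complexLaplacian hα u x)
  simp only [Complex.ofReal_re] at h
  exact h

theorem fracLaplacian_eq_laplacian {α : ℝ} (hα : 0 ≤ α) (u : Ell2 d) (x : Lattice d) :
    fracLaplacian α u x = (laplacian hα u x : ℂ) := by
  rw [fracLaplacian_eq hα]
  refine (hasSum_complexLaplacian hα u x).unique ?_
  exact Complex.hasSum_ofReal.2 (hasSum_laplacian hα u x)

theorem inner_laplacian {α : ℝ} (hα : 0 ≤ α) (u w : Ell2 d) :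
    inner ℝ (laplacian hα u) w =
      (inner ℂ (unitFourier d (complexify d w))
        (multiplier hα (unitFourier d (complexify d u)))).re := by
  rw [← inner_complexLaplacian, ← inner_conj_symm (𝕜 := ℂ), Complex.conj_re]
  exact inner_rePart _ w

theorem inner_laplacian_comm {α : ℝ} (hα : 0 ≤ α) (u w : Ell2 d) :
    inner ℝ (laplacian hα u) w = inner ℝ u (laplacian hα w) := by
  rw [real_inner_comm (laplacian hα w) u, inner_laplacian, inner_laplacian,
    ← inner_multiplier_left, ← inner_conj_symm (𝕜 := ℂ), Complex.conj_re]

theorem inner_laplacian_self_nonneg {α : ℝ} (hα : 0 ≤ α) (u : Ell2 d) :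
    0 ≤ inner ℝ (laplacian hα u) u := by
  rw [inner_laplacian]
  exact re_inner_multiplier_self hα _

/-- Symbol and potential are bounded, so H^α is all of ℓ². -/
theorem mem_HAlpha {α : ℝ} (hα : 0 ≤ α) {h : Lattice d → ℝ} {b : ℝ} (hh : ∀ x, |h x| ≤ b)
    (u : Ell2 d) : u ∈ HAlpha α h := by
  constructor
  · have h1 : Integrable (fun θ => ‖fourier u θ‖ ^ 2) (cubeMeasure d) :=
      (Lp.memLp (fourier u)).integrable_norm_pow (by norm_num)
    refine h1.bdd_mul (c := (4 * d) ^ α) (measurable_symbol_rpow α).aestronglyMeasurable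
      (Filter.Eventually.of_forall fun θ => ?_)
    rw [Real.norm_of_nonneg (Real.rpow_nonneg (symbol_nonneg θ) α)]
    exact symbol_rpow_le hα θ
  · have h1 : Summable fun x => |u x| ^ 2 := by
      have := (lp.memℓp u).summable (by norm_num)
      simpa using this
    refine .of_norm_bounded (h1.mul_left b) fun x => ?_
    rw [norm_mul, Real.norm_eq_abs, Real.norm_of_nonneg (sq_nonneg _)]
    exact mul_le_mul_of_nonneg_right (hh x) (sq_nonneg _)

/-- Translation of sequences. -/
noncomputable def shift (y : Lattice d) : Ell2 d →ₗᵢ[ℝ] Ell2 d where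
  toFun u := ⟨fun x => u (x - y), by
    refine memℓp_gen ?_
    exact ((Equiv.subRight y).summable_iff (f := fun x => ‖u x‖ ^ (2 : ENNReal).toReal)).2
      ((lp.memℓp u).summable (by norm_num))⟩
  map_add' u v := by ext x; simp; rfl
  map_smul' a u := by ext x; simp
  norm_map' u := by
    have h : (0 : ℝ) < (2 : ENNReal).toReal := by norm_num
    rw [lp.norm_eq_tsum_rpow h, lp.norm_eq_tsum_rpow h]
    congr 1
    exact (Equiv.subRight y).tsum_eq fun x => ‖u x‖ ^ (2 : ENNReal).toReal

@[simp] theorem shift_apply (y : Lattice d) (u : Ell2 d) (x : Lattice d) :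
    shift y u x = u (x - y) := rfl

theorem laplacian_shift {α : ℝ} (hα : 0 ≤ α) (y : Lattice d) (u : Ell2 d) :
    laplacian hα (shift y u) = shift y (laplacian hα u) := by
  ext x
  refine (hasSum_laplacian hα (shift y u) x).unique ?_
  rw [shift_apply, ← (Equiv.addRight y).hasSum_iff]
  convert! hasSum_laplacian hα u (x - y) using 2 with z
  simp [sub_sub_eq_add_sub]

end Fourier
/-! ### The variational problem -/

section Variational

open Filter Topology

/-- The equation `T u = u g(u)` on the lattice: a coercive symmetric operator commuting with
translations and an even function `g`, increasing on `[0, ∞)`, with a primitive `prim` of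
`s ↦ s g(s)`; the latter is described by its subgradient inequality in the variable `s²`. -/
structure Problem (d : ℕ) where
  /-- the linear part -/
  T : Ell2 d →L[ℝ] Ell2 d
  /-- the coercivity constant -/
  c : ℝ
  /-- the quotient of the nonlinearity by its argument -/
  g : ℝ → ℝ
  /-- the primitive of the nonlinearity -/
  prim : ℝ → ℝ
  c_pos : 0 < c
  T_symm : ∀ u w, inner ℝ (T u) w = inner ℝ u (T w)
  T_coercive : ∀ u, c * ‖u‖ ^ 2 ≤ inner ℝ (T u) u
  T_shift : ∀ y u, T (shift y u) = shift y (T u)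
  g_continuous : Continuous g
  g_neg : ∀ s, g (-s) = g s
  g_zero : g 0 = 0
  g_strictMono : StrictMonoOn g (Ici 0)
  prim_zero : prim 0 = 0
  prim_sub : ∀ a b, g a * (b ^ 2 - a ^ 2) / 2 ≤ prim b - prim a
  prim_superquadratic : ∀ M, ∃ R, 0 < R ∧ ∀ s, R < |s| → M * s ^ 2 ≤ prim s

theorem abs_apply_le_norm {d : ℕ} (u : Ell2 d) (x : Lattice d) : |u x| ≤ ‖u‖ :=
  lp.norm_apply_le_norm (by norm_num) u x

theorem hasSum_inner_mul {d : ℕ} (u w : Ell2 d) :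
    HasSum (fun x => u x * w x) (inner ℝ u w) := by
  simpa [RCLike.inner_apply, mul_comm] using lp.hasSum_inner (𝕜 := ℝ) u w

theorem norm_le_of_abs_le {d : ℕ} {u w : Ell2 d} {a : ℝ} (ha : 0 ≤ a)
    (h : ∀ x, |u x| ≤ a * |w x|) : ‖u‖ ≤ a * ‖w‖ := by
  have h1 : ‖u‖ ≤ ‖a • w‖ := lp.norm_mono (by norm_num) fun x => by
    simpa [abs_mul, abs_of_nonneg ha] using h x
  rwa [norm_smul, Real.norm_of_nonneg ha] at h1

namespace Problem

variable {d : ℕ} (p : Problem d)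

theorem g_abs (s : ℝ) : p.g |s| = p.g s := by
  rcases abs_choice s with h | h <;> rw [h]
  exact p.g_neg s

theorem g_le_of_abs_le {s t : ℝ} (h : |s| ≤ t) : p.g s ≤ p.g t := by
  rw [← p.g_abs s]
  exact p.g_strictMono.monotoneOn (abs_nonneg s) ((abs_nonneg s).trans h) h

theorem g_lt_of_abs_lt {s t : ℝ} (h : |s| < |t|) : p.g s < p.g t := by
  rw [← p.g_abs s, ← p.g_abs t]
  exact p.g_strictMono (abs_nonneg s) (abs_nonneg t) h

theorem g_nonneg (s : ℝ) : 0 ≤ p.g s := by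
  have := p.g_le_of_abs_le (s := 0) (t := |s|) (by simp)
  rwa [p.g_zero, p.g_abs] at this

theorem prim_nonneg (s : ℝ) : 0 ≤ p.prim s := by
  simpa [p.g_zero, p.prim_zero] using p.prim_sub 0 s

theorem prim_le (s : ℝ) : p.prim s ≤ p.g s * s ^ 2 / 2 := by
  have := p.prim_sub s 0
  rw [p.prim_zero] at this
  linarith

theorem prim_neg (s : ℝ) : p.prim (-s) = p.prim s := by
  have h1 := p.prim_sub s (-s)
  have h2 := p.prim_sub (-s) s
  simp only [neg_sq, sub_self, mul_zero, zero_div] at h1 h2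
  linarith

/-- Since the primitive is at most g(s)s²/2, its superquadratic growth forces g to infinity. -/
theorem exists_lt_g (M : ℝ) : ∃ R, 0 < R ∧ ∀ s, R < |s| → M < p.g s := by
  obtain ⟨R, hR, h⟩ := p.prim_superquadratic (|M| + 1)
  refine ⟨R, hR, fun s hs => ?_⟩
  have h1 := (h s hs).trans (p.prim_le s)
  have h2 : 0 < s ^ 2 := by
    rw [← sq_abs]
    have : 0 < |s| := hR.trans hs
    positivity
  have h3 : |M| + 1 ≤ p.g s / 2 := le_of_mul_le_mul_right (by linarith) h2
  linarith [le_abs_self M, abs_nonneg M]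

theorem exists_g_le {ε : ℝ} (hε : 0 < ε) : ∃ δ, 0 < δ ∧ ∀ s, |s| ≤ δ → p.g s ≤ ε := by
  have h1 : ∀ᶠ s in 𝓝 (0 : ℝ), p.g s < ε := by
    have := p.g_continuous.tendsto 0
    rw [p.g_zero] at this
    exact this.eventually (gt_mem_nhds hε)
  obtain ⟨δ, hδ, h⟩ := Metric.eventually_nhds_iff.1 h1
  refine ⟨δ / 2, by positivity, fun s hs => (h ?_).le⟩
  rw [Real.dist_eq, sub_zero]
  linarith

/-! ### The superposition operator and the energy -/

/-- Multiplication by `g(u)`. -/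
noncomputable def mulOp (u : Ell2 d) : Ell2 d →L[ℝ] Ell2 d :=
  LinearMap.mkContinuous
    { toFun := fun w => ⟨fun x => p.g (u x) * w x, by
        refine (lp.memℓp (p.g ‖u‖ • w)).mono' fun x => ?_
        rw [lp.coeFn_smul, Pi.smul_apply, norm_mul, norm_smul, Real.norm_of_nonneg (p.g_nonneg _),
          Real.norm_of_nonneg (p.g_nonneg _)]
        exact mul_le_mul_of_nonneg_right (p.g_le_of_abs_le (abs_apply_le_norm u x)) (norm_nonneg _)⟩
      map_add' := fun v w => by ext x; simp [mul_add]; rfl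
      map_smul' := fun a w => by ext x; simp [mul_left_comm] } (p.g ‖u‖) fun w => by
    refine norm_le_of_abs_le (p.g_nonneg _) fun x => ?_
    simp only [LinearMap.coe_mk, AddHom.coe_mk]
    rw [abs_mul, abs_of_nonneg (p.g_nonneg _)]
    exact mul_le_mul_of_nonneg_right (p.g_le_of_abs_le (abs_apply_le_norm u x)) (abs_nonneg _)

@[simp] theorem mulOp_apply (u w : Ell2 d) (x : Lattice d) : p.mulOp u w x = p.g (u x) * w x := rfl

theorem norm_mulOp_apply_le {u : Ell2 d} {σ : ℝ} (hu : ∀ x, |u x| ≤ σ) (w : Ell2 d) :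
    ‖p.mulOp u w‖ ≤ p.g σ * ‖w‖ :=
  norm_le_of_abs_le (p.g_nonneg _) fun x => by
    rw [mulOp_apply, abs_mul, abs_of_nonneg (p.g_nonneg _)]
    exact mul_le_mul_of_nonneg_right (p.g_le_of_abs_le (hu x)) (abs_nonneg _)

theorem mulOp_neg (u : Ell2 d) : p.mulOp (-u) = p.mulOp u := by
  ext w x
  simp [p.g_neg]

theorem mulOp_symm (u w z : Ell2 d) : inner ℝ (p.mulOp u w) z = inner ℝ w (p.mulOp u z) := by
  refine (hasSum_inner_mul (p.mulOp u w) z).unique ?_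
  convert! hasSum_inner_mul w (p.mulOp u z) using 2 with x
  simp only [mulOp_apply]
  ring

theorem hasSum_mulOp (u w : Ell2 d) :
    HasSum (fun x => p.g (u x) * w x ^ 2) (inner ℝ (p.mulOp u w) w) := by
  convert! hasSum_inner_mul (p.mulOp u w) w using 2 with x
  simp only [mulOp_apply]
  ring

theorem inner_mulOp_nonneg (u w : Ell2 d) : 0 ≤ inner ℝ (p.mulOp u w) w :=
  (p.hasSum_mulOp u w).nonneg fun _ => mul_nonneg (p.g_nonneg _) (sq_nonneg _)

theorem inner_mulOp_le {u : Ell2 d} {σ : ℝ} (hu : ∀ x, |u x| ≤ σ) (w : Ell2 d) :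
    inner ℝ (p.mulOp u w) w ≤ p.g σ * ‖w‖ ^ 2 := by
  refine (real_inner_le_norm _ _).trans ?_
  nlinarith [p.norm_mulOp_apply_le hu w, norm_nonneg w]

/-- Uniform continuity of `g` on bounded sets. -/
theorem exists_g_sub_lt (R : ℝ) {ε : ℝ} (hε : 0 < ε) : ∃ δ, 0 < δ ∧ ∀ s t, |s| ≤ R → |t| ≤ R →
    |s - t| < δ → |p.g s - p.g t| < ε := by
  have h1 := isCompact_Icc.uniformContinuousOn_of_continuous
    (p.g_continuous.continuousOn (s := Icc (-R) R))
  obtain ⟨δ, hδ, h⟩ := Metric.uniformContinuousOn_iff.1 h1 ε hε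
  exact ⟨δ, hδ, fun s t hs ht hst => h s (abs_le.1 hs) t (abs_le.1 ht) hst⟩

/-- The ℓ² norm dominates the sup norm, and g is uniformly continuous on bounded intervals; this
yields continuity in operator norm. -/
theorem continuous_mulOp : Continuous p.mulOp := by
  rw [Metric.continuous_iff]
  intro u ε hε
  obtain ⟨δ, hδ, h⟩ := p.exists_g_sub_lt (‖u‖ + 1) (half_pos hε)
  refine ⟨min δ 1, by positivity, fun w hw => ?_⟩
  rw [dist_eq_norm] at hw ⊢
  have hw1 : ‖w - u‖ < δ := hw.trans_le (min_le_left _ _)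
  have hw2 : ‖w - u‖ < 1 := hw.trans_le (min_le_right _ _)
  have hwn : ‖w‖ ≤ ‖u‖ + 1 := by linarith [norm_le_norm_add_norm_sub' w u]
  refine lt_of_le_of_lt ?_ (half_lt_self hε)
  refine ContinuousLinearMap.opNorm_le_bound _ (by positivity) fun z => ?_
  refine norm_le_of_abs_le (by positivity) fun x => ?_
  have : (p.mulOp w - p.mulOp u) z x = (p.g (w x) - p.g (u x)) * z x := by
    simp [sub_mul]
  rw [this, abs_mul]
  refine mul_le_mul_of_nonneg_right (h _ _ ((abs_apply_le_norm w x).trans hwn)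
    ((abs_apply_le_norm u x).trans (by linarith)) ?_).le (abs_nonneg _)
  refine lt_of_le_of_lt ?_ hw1
  simpa using abs_apply_le_norm (w - u) x

/-- The nonlinearity `u ↦ u g(u)` on `ℓ²`. -/
noncomputable def nonlin (u : Ell2 d) : Ell2 d := p.mulOp u u

theorem continuous_nonlin : Continuous p.nonlin := p.continuous_mulOp.clm_apply continuous_id

@[simp] theorem nonlin_apply (u : Ell2 d) (x : Lattice d) : p.nonlin u x = p.g (u x) * u x := rfl

theorem nonlin_neg (u : Ell2 d) : p.nonlin (-u) = -p.nonlin u := by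
  rw [nonlin, mulOp_neg, map_neg, nonlin]

theorem nonlin_shift (y : Lattice d) (u : Ell2 d) : p.nonlin (shift y u) = shift y (p.nonlin u) := by
  ext x; simp

theorem summable_prim (u : Ell2 d) : Summable fun x => p.prim (u x) := by
  refine .of_nonneg_of_le (fun x => p.prim_nonneg _) (fun x => p.prim_le _) ?_
  exact (p.hasSum_mulOp u u).summable.div_const 2

/-- The potential energy. -/
noncomputable def potential (u : Ell2 d) : ℝ := ∑' x, p.prim (u x)

/-- Convexity in the variable u², summed over the lattice. -/
theorem potential_sub_le (u w : Ell2 d) :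
    (inner ℝ (p.mulOp u w) w - inner ℝ (p.mulOp u u) u) / 2 ≤ p.potential w - p.potential u := by
  refine hasSum_le (fun x => ?_) (((p.hasSum_mulOp u w).sub (p.hasSum_mulOp u u)).div_const 2)
    ((p.summable_prim w).hasSum.sub (p.summable_prim u).hasSum)
  rw [← mul_sub]
  exact p.prim_sub _ _

theorem potential_zero : p.potential 0 = 0 := by simp [potential, p.prim_zero]

theorem potential_neg (u : Ell2 d) : p.potential (-u) = p.potential u := by
  simp [potential, p.prim_neg]

theorem potential_shift (y : Lattice d) (u : Ell2 d) :
    p.potential (shift y u) = p.potential u :=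
  (Equiv.subRight y).tsum_eq fun x => p.prim (u x)

/-- The subgradient inequalities based at `u` and at `w` squeeze the potential between continuous
functions agreeing at `u`. -/
theorem continuous_potential : Continuous p.potential := by
  rw [continuous_iff_continuousAt]
  intro u
  have hm := p.continuous_mulOp
  have h1 : Continuous fun w => p.potential u +
      (inner ℝ (p.mulOp u w) w - inner ℝ (p.mulOp u u) u) / 2 := by fun_prop
  have h2 : Continuous fun w => p.potential u +
      (inner ℝ (p.mulOp w w) w - inner ℝ (p.mulOp w u) u) / 2 := by
    have h3 : Continuous fun w => p.mulOp w w := hm.clm_apply continuous_id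
    have h4 : Continuous fun w => p.mulOp w u := hm.clm_apply continuous_const
    fun_prop
  have h1' := h1.tendsto u
  have h2' := h2.tendsto u
  simp only [sub_self, zero_div, add_zero] at h1' h2'
  refine tendsto_of_tendsto_of_tendsto_of_le_of_le h1' h2' (fun w => ?_) fun w => ?_
  · have := p.potential_sub_le u w
    simp only
    linarith
  · have := p.potential_sub_le w u
    simp only
    linarith

/-- The energy functional. -/
noncomputable def action (u : Ell2 d) : ℝ := inner ℝ (p.T u) u / 2 - p.potential u

theorem continuous_action : Continuous p.action := by
  have := p.continuous_potential
  unfold action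
  fun_prop

theorem action_neg (u : Ell2 d) : p.action (-u) = p.action u := by
  simp [action, p.potential_neg]

theorem action_shift (y : Lattice d) (u : Ell2 d) : p.action (shift y u) = p.action u := by
  rw [action, action, p.T_shift, p.potential_shift, LinearIsometry.inner_map_map]

/-! ### The Nehari set -/

/-- The Nehari set. -/
def Nehari (u : Ell2 d) : Prop := u ≠ 0 ∧ inner ℝ (p.mulOp u u) u = inner ℝ (p.T u) u

theorem inner_T_pos {u : Ell2 d} (hu : u ≠ 0) : 0 < inner ℝ (p.T u) u := by
  have h1 := p.T_coercive u
  have h2 : 0 < ‖u‖ := norm_pos_iff.2 hu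
  have h3 := p.c_pos
  have : 0 < p.c * ‖u‖ ^ 2 := by positivity
  linarith

-- On the Nehari set the forms of T and g(u) agree at `u`, so the terms in `u` of the subgradient
-- inequality are exactly those of the energy. The energy is thereby majorized by a quadratic form
-- in `w`.
variable {p} in
theorem Nehari.action_le {u : Ell2 d} (hu : p.Nehari u) (w : Ell2 d) :
    p.action w ≤ p.action u + (inner ℝ (p.T w) w - inner ℝ (p.mulOp u w) w) / 2 := by
  have h1 := p.potential_sub_le u w
  rw [hu.2] at h1
  simp only [action]
  linarith

-- The quadratic form in the previous bound vanishes on multiples of `u`: a Nehari point maximizes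
-- the energy on its line.
variable {p} in
theorem Nehari.action_smul_le {u : Ell2 d} (hu : p.Nehari u) (a : ℝ) :
    p.action (a • u) ≤ p.action u := by
  have h1 := hu.action_le (a • u)
  simp only [map_smul, inner_smul_left, inner_smul_right, hu.2] at h1
  simpa using h1

theorem action_zero : p.action 0 = 0 := by simp [action, p.potential_zero]

variable {p} in
theorem Nehari.action_nonneg {u : Ell2 d} (hu : p.Nehari u) : 0 ≤ p.action u := by
  have := hu.action_smul_le 0
  rwa [zero_smul, p.action_zero] at this

/-- Elements of the Nehari set are bounded away from zero. -/
theorem exists_le_norm_of_nehari : ∃ ρ, 0 < ρ ∧ ∀ u, p.Nehari u → ρ ≤ ‖u‖ := by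
  obtain ⟨ρ, hρ, h⟩ := p.exists_g_le (half_pos p.c_pos)
  refine ⟨ρ, hρ, fun u hu => ?_⟩
  by_contra! hlt
  have h1 := p.inner_mulOp_le (abs_apply_le_norm u) u
  have h2 := h ‖u‖ (by rw [abs_norm]; exact hlt.le)
  have h3 := p.T_coercive u
  rw [← hu.2] at h3
  have h4 : 0 < ‖u‖ ^ 2 := by
    have := norm_pos_iff.2 hu.1
    positivity
  have h5 : p.c ≤ p.c / 2 := le_of_mul_le_mul_right (by nlinarith) h4
  linarith [p.c_pos]

/-- The energy is coercive on the Nehari set. -/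
theorem exists_norm_le_of_nehari (D : ℝ) :
    ∃ R, 0 < R ∧ ∀ u, p.Nehari u → p.action u ≤ D → ‖u‖ ≤ R := by
  have hc := p.c_pos
  -- Chosen so that a vector of norm τ with all entries at most δ has energy at least cτ²/2 - cτ²/4
  -- = |D| + 1 > D.
  set τ := Real.sqrt (4 * (|D| + 1) / p.c) with hτ
  have hτ0 : 0 < τ := Real.sqrt_pos.2 (by positivity)
  have hτ2 : τ ^ 2 * p.c / 4 = |D| + 1 := by
    rw [hτ, Real.sq_sqrt (by positivity)]
    field_simp
  obtain ⟨δ, hδ, hg⟩ := p.exists_g_le (half_pos hc)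
  set β := δ / τ with hβ
  have hβ0 : 0 < β := by positivity
  set L := ‖p.T‖ with hL
  obtain ⟨R, hR, hF⟩ := p.prim_superquadratic ((L + 1) / β ^ 2)
  refine ⟨R / β, by positivity, fun u hu hD => ?_⟩
  have hn : 0 < ‖u‖ := norm_pos_iff.2 hu.1
  by_contra! hlt
  -- Either `u` is spread out, and its multiple of norm τ has too much energy for a ray whose
  -- maximum is at most D; or one entry is comparable to the norm, and superquadratic growth at that
  -- site makes the energy negative.
  by_cases hcase : ∀ x, |u x| ≤ β * ‖u‖
  · have h1 := hu.action_smul_le (τ / ‖u‖)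
    have h2 : p.potential ((τ / ‖u‖) • u) ≤ p.c / 2 * τ ^ 2 / 2 := by
      have h3 := p.potential_sub_le ((τ / ‖u‖) • u) 0
      rw [p.potential_zero] at h3
      have h4 : ∀ x, |((τ / ‖u‖) • u) x| ≤ δ := by
        intro x
        rw [lp.coeFn_smul, Pi.smul_apply, smul_eq_mul, abs_mul, abs_of_pos (by positivity)]
        calc τ / ‖u‖ * |u x| ≤ τ / ‖u‖ * (β * ‖u‖) := by gcongr; exact hcase x
          _ = δ := by rw [hβ]; field_simp
      have h5 := p.inner_mulOp_le h4 ((τ / ‖u‖) • u)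
      have h6 : ‖(τ / ‖u‖) • u‖ = τ := by
        rw [norm_smul, Real.norm_of_nonneg (by positivity)]; field_simp
      rw [h6] at h5
      have h7 : p.g δ * τ ^ 2 ≤ p.c / 2 * τ ^ 2 :=
        mul_le_mul_of_nonneg_right (hg δ (by rw [abs_of_pos hδ])) (sq_nonneg _)
      simp only [map_zero, inner_zero_right] at h3
      linarith
    have h8 := p.T_coercive ((τ / ‖u‖) • u)
    have h6 : ‖(τ / ‖u‖) • u‖ = τ := by
      rw [norm_smul, Real.norm_of_nonneg (by positivity)]; field_simp
    rw [h6] at h8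
    rw [action] at h1
    linarith [le_abs_self D]
  · push Not at hcase
    obtain ⟨x, hx⟩ := hcase
    have h1 : R < |u x| := by
      rw [div_lt_iff₀ hβ0] at hlt
      linarith
    have h2 := hF (u x) h1
    have h3 : p.prim (u x) ≤ p.potential u :=
      (p.summable_prim u).le_tsum x fun _ _ => p.prim_nonneg _
    have h4 := hu.action_nonneg
    rw [action] at h4
    have h5 : inner ℝ (p.T u) u ≤ L * ‖u‖ ^ 2 := by
      refine (real_inner_le_norm _ _).trans ?_
      nlinarith [p.T.le_opNorm u, norm_nonneg u]
    have h6 : (L + 1) * ‖u‖ ^ 2 ≤ (L + 1) / β ^ 2 * u x ^ 2 := by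
      have h7 : (β * ‖u‖) ^ 2 ≤ u x ^ 2 := by
        rw [← sq_abs (u x)]
        gcongr
      have hL0 : 0 ≤ L := norm_nonneg _
      calc (L + 1) * ‖u‖ ^ 2 = (L + 1) / β ^ 2 * (β * ‖u‖) ^ 2 := by field_simp
        _ ≤ _ := by gcongr
    have hL0 : 0 ≤ L := norm_nonneg _
    nlinarith [sq_nonneg ‖u‖, mul_nonneg hL0 (sq_nonneg ‖u‖), pow_pos hn 2]

end Problem

end Variational
section Descending

open Filter Topology

namespace Problem

variable {d : ℕ} (p : Problem d)

/-! ### The radial projection onto the Nehari set -/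

/-- The derivative of the energy along the ray through `v` at `t v`, divided by `-t`. -/
noncomputable def radial (t : ℝ) (v : Ell2 d) : ℝ :=
  inner ℝ (p.mulOp (t • v) v) v - inner ℝ (p.T v) v

theorem continuous_radial : Continuous fun q : ℝ × Ell2 d => p.radial q.1 q.2 := by
  have h1 : Continuous fun q : ℝ × Ell2 d => p.mulOp (q.1 • q.2) q.2 :=
    (p.continuous_mulOp.comp (continuous_fst.smul continuous_snd)).clm_apply continuous_snd
  unfold radial
  fun_prop

theorem radial_strictMono {v : Ell2 d} (hv : v ≠ 0) {s t : ℝ} (hs : 0 ≤ s) (hst : s < t) :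
    p.radial s v < p.radial t v := by
  obtain ⟨x, hx⟩ : ∃ x, v x ≠ 0 := by
    by_contra! h
    exact hv (lp.ext (funext h))
  have habs : ∀ y, |s * v y| ≤ |t * v y| := fun y => by
    rw [abs_mul, abs_mul, abs_of_nonneg hs, abs_of_nonneg (hs.trans hst.le)]
    gcongr
  refine sub_lt_sub_right (hasSum_lt (i := x) (fun y => ?_) ?_ (p.hasSum_mulOp (s • v) v)
    (p.hasSum_mulOp (t • v) v)) _
  · refine mul_le_mul_of_nonneg_right ?_ (sq_nonneg _)
    simp only [lp.coeFn_smul, Pi.smul_apply, smul_eq_mul]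
    rw [← p.g_abs (t * v y)]
    exact p.g_le_of_abs_le (habs y)
  · refine mul_lt_mul_of_pos_right ?_ (by positivity)
    simp only [lp.coeFn_smul, Pi.smul_apply, smul_eq_mul]
    refine p.g_lt_of_abs_lt ?_
    rw [abs_mul, abs_mul, abs_of_nonneg hs, abs_of_nonneg (hs.trans hst.le)]
    exact mul_lt_mul_of_pos_right hst (abs_pos.2 hx)

theorem radial_zero_neg {v : Ell2 d} (hv : v ≠ 0) : p.radial 0 v < 0 := by
  have h1 : p.mulOp 0 v = 0 := by ext x; simp [p.g_zero]
  rw [radial, zero_smul, h1, inner_zero_left, zero_sub, neg_lt_zero]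
  exact p.inner_T_pos hv

theorem exists_radial_pos {v : Ell2 d} (hv : v ≠ 0) : ∃ t, 0 < t ∧ 0 < p.radial t v := by
  obtain ⟨x, hx⟩ : ∃ x, v x ≠ 0 := by
    by_contra! h
    exact hv (lp.ext (funext h))
  obtain ⟨R, hR, h⟩ := p.exists_lt_g (inner ℝ (p.T v) v / v x ^ 2)
  have hx' : 0 < |v x| := abs_pos.2 hx
  refine ⟨(R + 1) / |v x|, by positivity, ?_⟩
  have h1 := h ((R + 1) / |v x| * v x) (by
    rw [abs_mul, abs_div, abs_abs, div_mul_cancel₀ _ hx'.ne', abs_of_pos (by positivity)]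
    linarith)
  rw [div_lt_iff₀ (by positivity)] at h1
  have h2 := le_hasSum (p.hasSum_mulOp (((R + 1) / |v x|) • v) v) x fun y _ =>
    mul_nonneg (p.g_nonneg _) (sq_nonneg _)
  simp only [lp.coeFn_smul, Pi.smul_apply, smul_eq_mul] at h2
  rw [radial]
  linarith

theorem exists_radial_eq_zero {v : Ell2 d} (hv : v ≠ 0) : ∃ t, 0 < t ∧ p.radial t v = 0 := by
  obtain ⟨t, ht, hpos⟩ := p.exists_radial_pos hv
  have hcont : ContinuousOn (fun s => p.radial s v) (Icc 0 t) :=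
    (p.continuous_radial.comp (continuous_id.prodMk continuous_const)).continuousOn
  obtain ⟨s, hs, hs0⟩ := intermediate_value_Icc ht.le hcont
    (show (0 : ℝ) ∈ Icc _ _ from ⟨(p.radial_zero_neg hv).le, hpos.le⟩)
  refine ⟨s, lt_of_le_of_ne hs.1 ?_, hs0⟩
  rintro rfl
  exact (p.radial_zero_neg hv).ne hs0

open Classical in
/-- The scaling that brings `v` to the Nehari set. -/
noncomputable def scale (v : Ell2 d) : ℝ :=
  if h : v ≠ 0 then Classical.choose (p.exists_radial_eq_zero h) else 1

theorem scale_pos (v : Ell2 d) : 0 < p.scale v := by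
  rw [scale]
  split_ifs with h
  · exact (Classical.choose_spec (p.exists_radial_eq_zero h)).1
  · exact one_pos

theorem radial_scale {v : Ell2 d} (hv : v ≠ 0) : p.radial (p.scale v) v = 0 := by
  rw [scale, dif_pos hv]
  exact (Classical.choose_spec (p.exists_radial_eq_zero hv)).2

theorem scale_lt_iff {v : Ell2 d} (hv : v ≠ 0) {t : ℝ} (ht : 0 ≤ t) :
    p.scale v < t ↔ 0 < p.radial t v := by
  rw [← p.radial_scale hv]
  refine ⟨p.radial_strictMono hv (p.scale_pos v).le, fun h => ?_⟩
  by_contra! hle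
  rcases hle.lt_or_eq with h' | rfl
  · exact absurd h (p.radial_strictMono hv ht h').not_gt
  · exact lt_irrefl _ h

theorem lt_scale_iff {v : Ell2 d} (hv : v ≠ 0) {t : ℝ} (ht : 0 ≤ t) :
    t < p.scale v ↔ p.radial t v < 0 := by
  rw [← p.radial_scale hv]
  refine ⟨p.radial_strictMono hv ht, fun h => ?_⟩
  by_contra! hle
  rcases hle.lt_or_eq with h' | rfl
  · exact absurd h (p.radial_strictMono hv (p.scale_pos v).le h').not_gt
  · exact lt_irrefl _ h

theorem scale_eq_of_radial {v : Ell2 d} (hv : v ≠ 0) {t : ℝ} (ht : 0 ≤ t)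
    (h : p.radial t v = 0) : p.scale v = t :=
  le_antisymm (not_lt.1 fun h' => ((p.lt_scale_iff hv ht).1 h').ne h)
    (not_lt.1 fun h' => ((p.scale_lt_iff hv ht).1 h').ne' h)

/-- By monotonicity along rays, comparing the scale with a number is a sign condition on the jointly
continuous radial function, hence an open condition. -/
theorem continuousAt_scale {v : Ell2 d} (hv : v ≠ 0) : ContinuousAt p.scale v := by
  have hne : ∀ᶠ w in 𝓝 v, w ≠ 0 := isOpen_ne.mem_nhds hv
  have hcont : ∀ t, Continuous (p.radial t) := fun t =>
    p.continuous_radial.comp (continuous_const.prodMk continuous_id)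
  refine tendsto_order.2 ⟨fun a ha => ?_, fun b hb => ?_⟩
  · rcases lt_or_ge a 0 with h0 | h0
    · exact Eventually.of_forall fun w => h0.trans (p.scale_pos w)
    · have := (p.lt_scale_iff hv h0).1 ha
      filter_upwards [hne, (hcont a).continuousAt.eventually (gt_mem_nhds this)] with w h1 h2
      exact (p.lt_scale_iff h1 h0).2 h2
  · have h0 : 0 ≤ b := (p.scale_pos v).le.trans hb.le
    have := (p.scale_lt_iff hv h0).1 hb
    filter_upwards [hne, (hcont b).continuousAt.eventually (lt_mem_nhds this)] with w h1 h2
    exact (p.scale_lt_iff h1 h0).2 h2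

theorem nehari_scale {v : Ell2 d} (hv : v ≠ 0) : p.Nehari (p.scale v • v) := by
  refine ⟨smul_ne_zero (p.scale_pos v).ne' hv, ?_⟩
  have h := p.radial_scale hv
  rw [radial, sub_eq_zero] at h
  simp only [map_smul, inner_smul_left, inner_smul_right, h]

theorem scale_neg (v : Ell2 d) : p.scale (-v) = p.scale v := by
  by_cases hv : v = 0
  · rw [hv, neg_zero]
  refine p.scale_eq_of_radial (neg_ne_zero.2 hv) (p.scale_pos v).le ?_
  rw [← p.radial_scale hv, radial, radial, smul_neg, mulOp_neg]
  simp

theorem scale_eq_of_nehari {v : Ell2 d} {t : ℝ} (ht : 0 < t) (h : p.Nehari (t • v)) :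
    p.scale v = t := by
  have hv : v ≠ 0 := (smul_ne_zero_iff.1 h.1).2
  refine p.scale_eq_of_radial hv ht.le ?_
  have h1 := h.2
  simp only [map_smul, inner_smul_left, inner_smul_right] at h1
  have h2 : t * (t * inner ℝ (p.mulOp (t • v) v) v) = t * (t * inner ℝ (p.T v) v) := by
    simpa using h1
  rw [radial, sub_eq_zero]
  exact mul_left_cancel₀ ht.ne' (mul_left_cancel₀ ht.ne' h2)

/-! ### The descent map -/

theorem exists_inverse : ∃ S : Ell2 d →L[ℝ] Ell2 d, ∀ u, p.T (S u) = u := by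
  have hB : IsCoercive ((innerSL ℝ).comp p.T : Ell2 d →L[ℝ] Ell2 d →L[ℝ] ℝ) := by
    refine ⟨p.c, p.c_pos, fun u => ?_⟩
    have := p.T_coercive u
    rw [sq, ← mul_assoc] at this
    exact this
  have h1 : ∀ u, hB.continuousLinearEquivOfBilin u = p.T u := by
    intro u
    refine ext_inner_right ℝ fun w => ?_
    rw [hB.continuousLinearEquivOfBilin_apply]
    rfl
  refine ⟨hB.continuousLinearEquivOfBilin.symm, fun u => ?_⟩
  rw [← h1]
  exact hB.continuousLinearEquivOfBilin.apply_symm_apply u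

/-- The inverse of the linear part. -/
noncomputable def inv : Ell2 d →L[ℝ] Ell2 d := Classical.choose p.exists_inverse

theorem T_inv (u : Ell2 d) : p.T (p.inv u) = u := Classical.choose_spec p.exists_inverse u

/-- One step of the fixed point iteration. -/
noncomputable def iter (u : Ell2 d) : Ell2 d := p.inv (p.nonlin u)

theorem T_iter (u : Ell2 d) : p.T (p.iter u) = p.nonlin u := p.T_inv _

variable {p} in
/-- One step of the fixed point iteration decreases the maximal energy along rays. -/
theorem Nehari.action_iter_le {u : Ell2 d} (hu : p.Nehari u) :
    ∀ t : ℝ, p.action (t • p.iter u) + inner ℝ (p.T (t • p.iter u)) (t • p.iter u) / 2 *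
      (p.c * (‖p.iter u - u‖ ^ 2) / inner ℝ (p.T u) u) ≤ p.action u := by
  intro t
  set z := p.iter u with hz
  set a := inner ℝ (p.T u) u with ha
  set b := inner ℝ (p.T z) z with hb
  set q := inner ℝ (p.mulOp u z) z with hq
  have ha0 : 0 < a := p.inner_T_pos hu.1
  have hTz : p.T z = p.mulOp u u := p.T_iter u
  have hzu : inner ℝ (p.T z) u = a := by rw [hTz, hu.2]
  have huz : inner ℝ (p.T u) z = a := by rw [p.T_symm, real_inner_comm, hzu]
  have hmz : inner ℝ (p.mulOp u u) z = b := by rw [← hTz]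
  have hmz' : inner ℝ (p.mulOp u z) u = b := by rw [p.mulOp_symm, real_inner_comm, hmz]
  have he : p.c * ‖z - u‖ ^ 2 ≤ b - a := by
    have h1 := p.T_coercive (z - u)
    simp only [map_sub, inner_sub_left, inner_sub_right] at h1
    linarith
  have hb0 : 0 ≤ b := by
    have := p.T_coercive z
    have h2 : 0 ≤ p.c * ‖z‖ ^ 2 := mul_nonneg p.c_pos.le (sq_nonneg _)
    linarith
  -- Cauchy–Schwarz for the semidefinite form of g(u), in which the pairs (u,u), (u,z), (z,z) give
  -- a, b, q; obtained by testing with z - (b/a)u.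
  have hCS : b ^ 2 / a ≤ q := by
    have h1 := p.inner_mulOp_nonneg u (z - (b / a) • u)
    simp only [map_sub, map_smul, inner_sub_left, inner_sub_right, inner_smul_left,
      inner_smul_right] at h1
    rw [hmz, hmz', hu.2] at h1
    simp only [conj_trivial] at h1
    have h2 : q - b / a * b - (b / a * b - b / a * (b / a * a)) = q - b ^ 2 / a := by
      field_simp; ring
    linarith
  -- The energy at tz exceeds that at u by at most t²(b - q)/2 ≤ -t²b(b - a)/(2a), while b - a =
  -- ⟨T(z-u), z-u⟩ controls ‖z - u‖².
  have h1 := hu.action_le (t • z)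
  simp only [map_smul, inner_smul_left, inner_smul_right, conj_trivial] at h1 ⊢
  have h2 : t * (t * b) / 2 * (p.c * ‖z - u‖ ^ 2 / a) ≤ t * (t * b) / 2 * ((b - a) / a) := by
    have : 0 ≤ t * (t * b) / 2 := by
      rw [← mul_assoc]
      exact div_nonneg (mul_nonneg (mul_self_nonneg t) hb0) (by norm_num)
    gcongr
  have h3 : t * (t * b) / 2 * ((b - a) / a) = t ^ 2 / 2 * (b ^ 2 / a) - t ^ 2 / 2 * b := by
    field_simp
  have h4 : t ^ 2 / 2 * (b ^ 2 / a) ≤ t ^ 2 / 2 * q := by gcongr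
  linarith

variable {p} in
theorem Nehari.iter_ne_zero {u : Ell2 d} (hu : p.Nehari u) : p.iter u ≠ 0 := by
  intro h
  have h1 := p.T_iter u
  rw [h, map_zero] at h1
  have h2 := hu.2
  rw [show p.mulOp u u = 0 from h1.symm, inner_zero_left] at h2
  exact (p.inner_T_pos hu.1).ne h2

theorem iter_neg (u : Ell2 d) : p.iter (-u) = -p.iter u := by
  rw [iter, nonlin_neg, map_neg, iter]

theorem continuous_iter : Continuous p.iter := p.inv.continuous.comp p.continuous_nonlin

end Problem

/-! ### The reduced energy and the descent map on the sphere -/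

/-- The unit sphere of `ℓ²`. -/
abbrev USphere (d : ℕ) : Type := Metric.sphere (0 : Ell2 d) 1

theorem norm_normalize_sub_le {E : Type*} [NormedAddCommGroup E] [NormedSpace ℝ E] {x y : E}
    (hx : x ≠ 0) (hy : y ≠ 0) : ‖‖y‖⁻¹ • y - ‖x‖⁻¹ • x‖ ≤ 2 * (‖y - x‖ / ‖x‖) := by
  have hx' : 0 < ‖x‖ := norm_pos_iff.2 hx
  have hy' : 0 < ‖y‖ := norm_pos_iff.2 hy
  have h1 : ‖y‖⁻¹ • y - ‖x‖⁻¹ • x = (‖y‖⁻¹ - ‖x‖⁻¹) • y + ‖x‖⁻¹ • (y - x) := by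
    rw [sub_smul, smul_sub]; abel
  rw [h1]
  refine (norm_add_le _ _).trans ?_
  rw [norm_smul, norm_smul, Real.norm_eq_abs, norm_inv, norm_norm]
  have h2 : |‖y‖⁻¹ - ‖x‖⁻¹| * ‖y‖ ≤ ‖y - x‖ / ‖x‖ := by
    have h3 : |‖y‖⁻¹ - ‖x‖⁻¹| * ‖y‖ = |‖x‖ - ‖y‖| / ‖x‖ := by
      rw [← abs_of_pos hy', ← abs_mul, abs_of_pos hy']
      have : (‖y‖⁻¹ - ‖x‖⁻¹) * ‖y‖ = (‖x‖ - ‖y‖) / ‖x‖ := by field_simp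
      rw [this, abs_div, abs_of_pos hx']
    rw [h3, norm_sub_rev]
    gcongr
    exact abs_norm_sub_norm_le x y
  have h4 : ‖x‖⁻¹ * ‖y - x‖ = ‖y - x‖ / ‖x‖ := by rw [inv_mul_eq_div]
  linarith

namespace Problem

variable {d : ℕ} (p : Problem d)

theorem usphere_ne_zero (v : USphere d) : (v : Ell2 d) ≠ 0 := by
  have := norm_eq_of_mem_sphere v
  rw [← norm_pos_iff, this]
  exact one_pos

/-- The point of the Nehari set over a point of the sphere. -/
noncomputable def lift (v : USphere d) : Ell2 d := p.scale v • (v : Ell2 d)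

theorem nehari_lift (v : USphere d) : p.Nehari (p.lift v) := p.nehari_scale (usphere_ne_zero v)

theorem norm_lift (v : USphere d) : ‖p.lift v‖ = p.scale v := by
  rw [lift, norm_smul, norm_eq_of_mem_sphere v, mul_one, Real.norm_of_nonneg (p.scale_pos _).le]

theorem normalize_lift (v : USphere d) : ‖p.lift v‖⁻¹ • p.lift v = v := by
  rw [norm_lift, lift, smul_smul, inv_mul_cancel₀ (p.scale_pos _).ne', one_smul]

theorem continuous_lift : Continuous p.lift := by
  have : Continuous fun v : USphere d => p.scale v := by
    rw [continuous_iff_continuousAt]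
    intro v
    exact (p.continuousAt_scale (usphere_ne_zero v)).comp continuous_subtype_val.continuousAt
  exact this.smul continuous_subtype_val

theorem lift_neg (v : USphere d) : p.lift (-v) = -p.lift v := by
  simp [lift, scale_neg]

/-- The reduced energy on the sphere. -/
noncomputable def reduced (v : USphere d) : ℝ := p.action (p.lift v)

/-- The normalized fixed point iteration. -/
noncomputable def descend (v : USphere d) : USphere d :=
  ⟨‖p.iter (p.lift v)‖⁻¹ • p.iter (p.lift v), by
    rw [mem_sphere_zero_iff_norm, norm_smul, norm_inv, norm_norm,
      inv_mul_cancel₀ (norm_ne_zero_iff.2 (p.nehari_lift v).iter_ne_zero)]⟩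

theorem continuous_descend : Continuous p.descend := by
  have h1 : Continuous fun v => p.iter (p.lift v) := p.continuous_iter.comp p.continuous_lift
  exact Continuous.subtype_mk ((h1.norm.inv₀ fun v =>
    norm_ne_zero_iff.2 (p.nehari_lift v).iter_ne_zero).smul h1) _

theorem descend_neg (v : USphere d) : p.descend (-v) = -p.descend v := by
  ext1
  simp [descend, lift_neg, iter_neg]

/-- The energy loss of the descent map controls the defect of the equation. -/
theorem exists_descent_rate : ∃ r, 0 < r ∧ ∀ v : USphere d,
    r * (‖p.iter (p.lift v) - p.lift v‖ / ‖p.lift v‖) ^ 2 ≤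
      p.reduced v - p.reduced (p.descend v) := by
  obtain ⟨ρ, hρ, hN⟩ := p.exists_le_norm_of_nehari
  have hc := p.c_pos
  -- The new Nehari point has ⟨Tw,w⟩ ≥ cρ², and the old one has ⟨Tu,u⟩ ≤ (‖T‖ + 1)‖u‖².
  refine ⟨p.c * ρ ^ 2 / 2 * (p.c / (‖p.T‖ + 1)), by positivity, fun v => ?_⟩
  set u := p.lift v with hu
  have huN : p.Nehari u := p.nehari_lift v
  set z := p.iter u with hz
  have hw : p.lift (p.descend v) = (p.scale (p.descend v) * ‖z‖⁻¹) • z := by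
    rw [lift, descend, smul_smul]
  have h1 := huN.action_iter_le (p.scale (p.descend v) * ‖z‖⁻¹)
  rw [← hz, ← hw] at h1
  set w := p.lift (p.descend v) with hwdef
  have h2 : p.c * ρ ^ 2 ≤ inner ℝ (p.T w) w := by
    refine le_trans ?_ (p.T_coercive w)
    gcongr
    exact hN w (p.nehari_lift _)
  have hu0 : 0 < ‖u‖ := norm_pos_iff.2 huN.1
  have h3 : inner ℝ (p.T u) u ≤ (‖p.T‖ + 1) * ‖u‖ ^ 2 := by
    refine (real_inner_le_norm _ _).trans ?_
    nlinarith [p.T.le_opNorm u, norm_nonneg u]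
  have h4 : 0 < inner ℝ (p.T u) u := p.inner_T_pos huN.1
  have h5 : p.c * ρ ^ 2 / 2 * (p.c / (‖p.T‖ + 1)) * (‖z - u‖ / ‖u‖) ^ 2 ≤
      inner ℝ (p.T w) w / 2 * (p.c * ‖z - u‖ ^ 2 / inner ℝ (p.T u) u) := by
    rw [mul_assoc]
    have h6 : p.c / (‖p.T‖ + 1) * (‖z - u‖ / ‖u‖) ^ 2 =
        p.c * ‖z - u‖ ^ 2 / ((‖p.T‖ + 1) * ‖u‖ ^ 2) := by
      have : 0 < ‖p.T‖ + 1 := by positivity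
      field_simp
    rw [h6]
    gcongr
    exact div_nonneg (le_trans (by positivity) h2) (by norm_num)
  simp only [reduced]
  rw [← hu, ← hwdef]
  linarith

end Problem

end Descending
section Compactness

open Filter Topology

variable {d : ℕ}

/-! ### Bounded pointwise convergent sequences -/

/-- Bounded pointwise convergence is weak convergence: truncate `a` to a finite set. -/
theorem tendsto_inner_of_tendsto_pointwise {v : ℕ → Ell2 d} {w : Ell2 d} {C : ℝ}
    (hv : ∀ n, ‖v n‖ ≤ C) (h : ∀ x, Tendsto (fun n => v n x) atTop (𝓝 (w x))) (a : Ell2 d) :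
    Tendsto (fun n => inner ℝ a (v n)) atTop (𝓝 (inner ℝ a w)) := by
  classical
  have hC : 0 ≤ C := (norm_nonneg _).trans (hv 0)
  have hsum : HasSum (fun x => lp.single 2 x (a x)) a :=
    lp.hasSum_single (E := fun _ : Lattice d => ℝ) (p := 2) (by norm_num) a
  rw [Metric.tendsto_atTop]
  intro ε hε
  set K := C + ‖w‖ + 1 with hK
  have hK0 : 0 < K := by positivity
  obtain ⟨s, hs⟩ := ((Metric.tendsto_nhds.1 hsum) (ε / (2 * K)) (by positivity)).exists
  set b := ∑ x ∈ s, (lp.single 2 x (a x) : Ell2 d) with hb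
  have h1 : Tendsto (fun n => inner ℝ b (v n - w)) atTop (𝓝 0) := by
    have h2 : ∀ z : Ell2 d, inner ℝ b z = ∑ x ∈ s, a x * z x := by
      intro z
      rw [hb, sum_inner]
      refine Finset.sum_congr rfl fun x _ => ?_
      rw [lp.inner_single_left]
      simp [mul_comm]
    simp only [h2]
    have h3 : Tendsto (fun n => ∑ x ∈ s, a x * (v n - w) x) atTop (𝓝 (∑ x ∈ s, a x * (w x - w x))) := by
      refine tendsto_finsetSum _ fun x _ => ?_
      simp only [lp.coeFn_sub, Pi.sub_apply]
      exact ((h x).sub_const _).const_mul _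
    simpa using h3
  obtain ⟨N, hN⟩ := Metric.tendsto_atTop.1 h1 (ε / 2) (by positivity)
  refine ⟨N, fun n hn => ?_⟩
  have h4 := hN n hn
  rw [Real.dist_eq, sub_zero] at h4
  rw [Real.dist_eq, ← inner_sub_right]
  have h5 : inner ℝ a (v n - w) = inner ℝ (a - b) (v n - w) + inner ℝ b (v n - w) := by
    rw [inner_sub_left]; ring
  have h6 : |inner ℝ (a - b) (v n - w)| ≤ ε / (2 * K) * K := by
    refine (abs_real_inner_le_norm _ _).trans ?_
    have h7 : ‖a - b‖ ≤ ε / (2 * K) := by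
      rw [norm_sub_rev, ← dist_eq_norm]; exact hs.le
    have h8 : ‖v n - w‖ ≤ K := by linarith [norm_sub_le (v n) w, hv n]
    gcongr
  have h9 : ε / (2 * K) * K = ε / 2 := by field_simp
  rw [h5]
  linarith [abs_add_le (inner ℝ (a - b) (v n - w)) (inner ℝ b (v n - w))]

theorem exists_limit_of_tendsto_pointwise {v : ℕ → Ell2 d} {φ : Lattice d → ℝ} {C : ℝ}
    (hv : ∀ n, ‖v n‖ ≤ C) (h : ∀ x, Tendsto (fun n => v n x) atTop (𝓝 (φ x))) :
    ∃ w : Ell2 d, ∀ x, Tendsto (fun n => v n x) atTop (𝓝 (w x)) := by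
  have hb : Bornology.IsBounded (range v) :=
    isBounded_iff_forall_norm_le.2 ⟨C, by rintro _ ⟨n, rfl⟩; exact hv n⟩
  exact ⟨⟨φ, lp.memℓp_of_tendsto (E := fun _ : Lattice d => ℝ) (p := 2) hb
    (tendsto_pi_nhds.2 h)⟩, h⟩

theorem norm_le_of_tendsto_pointwise {v : ℕ → Ell2 d} {w : Ell2 d} {C : ℝ}
    (hv : ∀ n, ‖v n‖ ≤ C) (h : ∀ x, Tendsto (fun n => v n x) atTop (𝓝 (w x))) : ‖w‖ ≤ C :=
  lp.norm_le_of_tendsto (E := fun _ : Lattice d => ℝ) (p := 2)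
    (Eventually.of_forall hv) (tendsto_pi_nhds.2 h)

theorem exists_subseq_tendsto {v w : ℕ → Ell2 d} {t s : ℕ → ℝ} {C R : ℝ}
    (hv : ∀ n, ‖v n‖ ≤ C) (hw : ∀ n, ‖w n‖ ≤ C) (ht : ∀ n, t n ∈ Icc 0 R)
    (hs : ∀ n, s n ∈ Icc 0 R) :
    ∃ (φ : ℕ → ℕ) (v' w' : Ell2 d) (a b : ℝ), StrictMono φ ∧
      (∀ x, Tendsto (fun n => v (φ n) x) atTop (𝓝 (v' x))) ∧
      (∀ x, Tendsto (fun n => w (φ n) x) atTop (𝓝 (w' x))) ∧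
      Tendsto (fun n => t (φ n)) atTop (𝓝 a) ∧ Tendsto (fun n => s (φ n)) atTop (𝓝 b) := by
  have hP : IsCompact (univ.pi fun _ : Lattice d => Icc (-C) C) :=
    isCompact_univ_pi fun _ => isCompact_Icc
  have hK := (hP.prod hP).prod ((isCompact_Icc (a := (0 : ℝ)) (b := R)).prod
    (isCompact_Icc (a := (0 : ℝ)) (b := R)))
  obtain ⟨q, -, φ, hφ, hlim⟩ := hK.tendsto_subseq
    (x := fun n => ((⇑(v n), ⇑(w n)), (t n, s n))) fun n =>
      ⟨⟨fun x _ => abs_le.1 ((abs_apply_le_norm _ x).trans (hv n)),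
        fun x _ => abs_le.1 ((abs_apply_le_norm _ x).trans (hw n))⟩, ht n, hs n⟩
  have h1 := (continuous_fst.tendsto q).comp hlim
  have h2 := (continuous_snd.tendsto q).comp hlim
  obtain ⟨v', hv'⟩ := exists_limit_of_tendsto_pointwise (v := fun n => v (φ n))
    (fun n => hv _) (tendsto_pi_nhds.1 ((continuous_fst.tendsto q.1).comp h1))
  obtain ⟨w', hw'⟩ := exists_limit_of_tendsto_pointwise (v := fun n => w (φ n))
    (fun n => hw _) (tendsto_pi_nhds.1 ((continuous_snd.tendsto q.1).comp h1))
  exact ⟨φ, v', w', q.2.1, q.2.2, hφ, hv', hw', (continuous_fst.tendsto q.2).comp h2,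
    (continuous_snd.tendsto q.2).comp h2⟩

/-! ### Separation of translates -/

theorem exists_pos_forall_of_finite {ι : Type*} {s : Set ι} (hs : s.Finite) {P : ℝ → ι → Prop}
    (hmono : ∀ i κ κ', κ' ≤ κ → P κ i → P κ' i) (h : ∀ i ∈ s, ∃ κ, 0 < κ ∧ P κ i) :
    ∃ κ, 0 < κ ∧ ∀ i ∈ s, P κ i := by
  have h1 : ∀ i ∈ s, ∀ᶠ κ in 𝓝[>] (0 : ℝ), P κ i := by
    intro i hi
    obtain ⟨κ, hκ, hP⟩ := h i hi
    filter_upwards [Ioo_mem_nhdsGT hκ] with κ' hκ'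
    exact hmono i κ κ' hκ'.2.le hP
  have h2 := ((Set.Finite.eventually_all hs).2 h1).and self_mem_nhdsWithin
  obtain ⟨κ, h3, h4⟩ := h2.exists
  exact ⟨κ, h4, h3⟩

/-- Elements of ℓ² decay, so at a site where `q` is nonzero all but finitely many translates of `r`
are less than half as large. -/
theorem exists_separation_shift (q r : Ell2 d) :
    ∃ κ, 0 < κ ∧ ∀ y, q = shift y r ∨ κ ≤ ‖q - shift y r‖ := by
  by_cases hq : q = 0
  · by_cases hr : r = 0
    · exact ⟨1, one_pos, fun y => Or.inl (by rw [hq, hr, map_zero])⟩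
    · refine ⟨‖r‖, norm_pos_iff.2 hr, fun y => Or.inr ?_⟩
      rw [hq, zero_sub, norm_neg, LinearIsometry.norm_map]
  obtain ⟨x, hx⟩ : ∃ x, q x ≠ 0 := by
    by_contra! h
    exact hq (lp.ext (funext h))
  have hb : 0 < |q x| := abs_pos.2 hx
  have hlim : Tendsto (fun z => |r z| ^ 2) cofinite (𝓝 0) := by
    have := ((lp.memℓp r).summable (by norm_num)).tendsto_cofinite_zero
    simpa using this
  have hfin : {z | ¬ |r z| ^ 2 < (|q x| / 2) ^ 2}.Finite :=
    hlim.eventually (gt_mem_nhds (by positivity))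
  have hfin' : {y | ¬ |r (x - y)| ^ 2 < (|q x| / 2) ^ 2}.Finite :=
    hfin.preimage (sub_right_injective.injOn)
  obtain ⟨κ, hκ, h⟩ := exists_pos_forall_of_finite hfin'
    (P := fun κ y => q = shift y r ∨ κ ≤ ‖q - shift y r‖)
    (fun y κ κ' hle h => h.imp_right hle.trans) (fun y _ => by
      by_cases h : q = shift y r
      · exact ⟨1, one_pos, Or.inl h⟩
      · exact ⟨‖q - shift y r‖, norm_pos_iff.2 (sub_ne_zero.2 h), Or.inr le_rfl⟩)
  refine ⟨min κ (|q x| / 2), by positivity, fun y => ?_⟩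
  by_cases hy : |r (x - y)| ^ 2 < (|q x| / 2) ^ 2
  · right
    have h1 : |r (x - y)| < |q x| / 2 := lt_of_pow_lt_pow_left₀ 2 (by positivity) hy
    have h2 := abs_apply_le_norm (q - shift y r) x
    simp only [lp.coeFn_sub, Pi.sub_apply, shift_apply] at h2
    have h3 := abs_sub_abs_le_abs_sub (q x) (r (x - y))
    linarith [min_le_right κ (|q x| / 2)]
  · exact (h y hy).imp_right (min_le_left _ _).trans

theorem shift_shift (y z : Lattice d) (u : Ell2 d) : shift y (shift z u) = shift (y + z) u := by
  ext x; simp [sub_sub]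

/-- Finitely many translation orbits form a uniformly discrete set. -/
theorem exists_separation_orbits (F : Finset (Ell2 d)) : ∃ κ, 0 < κ ∧ ∀ q ∈ F, ∀ r ∈ F, ∀ y z,
    shift y q ≠ shift z r → κ ≤ ‖shift y q - shift z r‖ := by
  obtain ⟨κ, hκ, h⟩ := exists_pos_forall_of_finite (F ×ˢ F).finite_toSet
    (P := fun κ (i : Ell2 d × Ell2 d) => ∀ y, i.1 = shift y i.2 ∨ κ ≤ ‖i.1 - shift y i.2‖)
    (fun i κ κ' hle h y => (h y).imp_right hle.trans) fun i _ => exists_separation_shift i.1 i.2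
  refine ⟨κ, hκ, fun q hq r hr y z hne => ?_⟩
  have h1 : shift z r = shift y (shift (z - y) r) := by
    rw [shift_shift, add_sub_cancel]
  rw [h1] at hne ⊢
  rw [← map_sub, LinearIsometry.norm_map]
  refine (h (q, r) (by simp [hq, hr]) (z - y)).resolve_left fun h2 => hne ?_
  exact congrArg (shift y) h2

end Compactness

section Multiplicity

open Filter Topology

namespace Problem

variable {d : ℕ} (p : Problem d)

/-! ### Clusters of almost critical points -/

/-- The defect of the equation. -/
noncomputable def defect (u : Ell2 d) : Ell2 d := p.T u - p.nonlin u

theorem defect_shift (y : Lattice d) (u : Ell2 d) : p.defect (shift y u) = shift y (p.defect u) := by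
  rw [defect, p.T_shift, p.nonlin_shift, ← map_sub, defect]

theorem nehari_of_defect_eq_zero {u : Ell2 d} (hu : u ≠ 0) (h : p.defect u = 0) : p.Nehari u := by
  refine ⟨hu, ?_⟩
  rw [defect, sub_eq_zero] at h
  rw [h, nonlin]

/-- Almost critical points that are uniformly close are close in `ℓ²`. -/
theorem exists_norm_sub_lt {R : ℝ} (hR : 0 < R) {ε : ℝ} (hε : 0 < ε) : ∃ δ, 0 < δ ∧ ∀ u w,
    ‖u‖ ≤ R → ‖w‖ ≤ R → ‖p.defect u‖ ≤ δ → ‖p.defect w‖ ≤ δ → (∀ x, |u x - w x| ≤ δ) →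
      ‖u - w‖ < ε := by
  have hc := p.c_pos
  obtain ⟨ρ, hρ, hg⟩ := p.exists_g_le (half_pos hc)
  set A := p.c * ε ^ 2 / 2 with hA
  have hA0 : 0 < A := by positivity
  set K := p.g R * (R ^ 2 / ρ ^ 2) with hK
  have hK0 : 0 ≤ K := mul_nonneg (p.g_nonneg _) (by positivity)
  set η := A / (8 * R ^ 2) with hη
  have hη0 : 0 < η := by positivity
  obtain ⟨δ₁, hδ₁, hu⟩ := p.exists_g_sub_lt R hη0
  set δ := min (min 1 (A / (4 * (4 * R + K)))) (δ₁ / 2) with hδ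
  have hδ0 : 0 < δ := by positivity
  have hδ1 : δ ≤ 1 := (min_le_left _ _).trans (min_le_left _ _)
  have hδA : (4 * R + K) * δ ≤ A / 4 := by
    have : δ ≤ A / (4 * (4 * R + K)) := (min_le_left _ _).trans (min_le_right _ _)
    rw [le_div_iff₀ (by positivity)] at this
    linarith
  have hδδ : δ < δ₁ := by linarith [min_le_right (min 1 (A / (4 * (4 * R + K)))) (δ₁ / 2)]
  refine ⟨δ, hδ0, fun u w huR hwR hdu hdw hx => ?_⟩
  set y := u - w with hy
  have hyx : ∀ x, y x = u x - w x := fun x => rfl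
  have hyR : ‖y‖ ≤ 2 * R := by linarith [norm_sub_le u w]
  have hux : ∀ x, |u x| ≤ R := fun x => (abs_apply_le_norm u x).trans huR
  have hwx : ∀ x, |w x| ≤ R := fun x => (abs_apply_le_norm w x).trans hwR
  -- Pair this with y. The first term is small by hypothesis, the second by uniform continuity of g.
  have e1 : p.T y = p.defect u - p.defect w + (p.mulOp u w - p.mulOp w w) + p.mulOp u y := by
    rw [hy]
    simp only [map_sub, defect, nonlin]
    abel
  have h1 : inner ℝ (p.defect u - p.defect w) y ≤ 2 * δ * (2 * R) := by
    refine (real_inner_le_norm _ _).trans ?_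
    have : ‖p.defect u - p.defect w‖ ≤ 2 * δ := by
      linarith [norm_sub_le (p.defect u) (p.defect w)]
    gcongr
  have h2 : inner ℝ (p.mulOp u w - p.mulOp w w) y ≤ η * R * (2 * R) := by
    refine (real_inner_le_norm _ _).trans ?_
    have : ‖p.mulOp u w - p.mulOp w w‖ ≤ η * ‖w‖ := by
      refine norm_le_of_abs_le hη0.le fun x => ?_
      have e2 : (p.mulOp u w - p.mulOp w w) x = (p.g (u x) - p.g (w x)) * w x := by
        simp [sub_mul]
      rw [e2, abs_mul]
      exact mul_le_mul_of_nonneg_right (hu _ _ (hux x) (hwx x) ((hx x).trans_lt hδδ)).le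
        (abs_nonneg _)
    have h3 : η * ‖w‖ ≤ η * R := by gcongr
    gcongr
    exact this.trans h3
  -- Where |u(x)| ≤ ρ, g is at most c/2 and coercivity absorbs the term. There are at most R²/ρ²
  -- other sites, each contributing at most g(R)δ².
  have h3 : inner ℝ (p.mulOp u y) y ≤ p.c / 2 * ‖y‖ ^ 2 + K * δ ^ 2 := by
    have hs := ((hasSum_inner_mul y y).mul_left (p.c / 2)).add
      ((hasSum_inner_mul u u).mul_left (p.g R * δ ^ 2 / ρ ^ 2))
    have hle := hasSum_le (fun x => ?_) (p.hasSum_mulOp u y) hs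
    · refine hle.trans ?_
      rw [real_inner_self_eq_norm_sq, real_inner_self_eq_norm_sq]
      have h4 : p.g R * δ ^ 2 / ρ ^ 2 * ‖u‖ ^ 2 ≤ p.g R * δ ^ 2 / ρ ^ 2 * R ^ 2 := by
        have := p.g_nonneg R
        gcongr
      have h5 : p.g R * δ ^ 2 / ρ ^ 2 * R ^ 2 = K * δ ^ 2 := by rw [hK]; ring
      linarith
    · have hgR := p.g_nonneg R
      have h7 : 0 ≤ p.g R * δ ^ 2 / ρ ^ 2 * (u x * u x) :=
        mul_nonneg (by positivity) (mul_self_nonneg _)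
      have h8 : 0 ≤ p.c / 2 * (y x * y x) := mul_nonneg (by positivity) (mul_self_nonneg _)
      by_cases hcase : |u x| ≤ ρ
      · have h6 := mul_le_mul_of_nonneg_right (hg (u x) hcase) (mul_self_nonneg (y x))
        rw [sq]
        linarith
      · have h9 : p.g (u x) * y x ^ 2 ≤ p.g R * δ ^ 2 := by
          have h10 : y x ^ 2 ≤ δ ^ 2 := by
            rw [← sq_abs, hyx]
            have := hx x
            gcongr
          exact mul_le_mul (p.g_le_of_abs_le (hux x)) h10 (sq_nonneg _) hgR
        have h11 : 1 ≤ (u x * u x) / ρ ^ 2 := by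
          rw [one_le_div (by positivity), ← sq, ← sq_abs (u x)]
          have := (not_le.1 hcase).le
          gcongr
        have h12 : p.g R * δ ^ 2 ≤ p.g R * δ ^ 2 * ((u x * u x) / ρ ^ 2) :=
          le_mul_of_one_le_right (by positivity) h11
        have h13 : p.g R * δ ^ 2 / ρ ^ 2 * (u x * u x) =
            p.g R * δ ^ 2 * ((u x * u x) / ρ ^ 2) := by ring
        linarith
  have h4 := p.T_coercive y
  rw [e1, inner_add_left, inner_add_left] at h4
  have h5 : η * R * (2 * R) = A / 4 := by rw [hη]; field_simp; ring
  have h6 : K * δ ^ 2 ≤ K * δ := by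
    gcongr
    nlinarith
  have h7 : p.c / 2 * ‖y‖ ^ 2 < p.c / 2 * ε ^ 2 := by
    have : A = p.c / 2 * ε ^ 2 := by rw [hA]; ring
    nlinarith
  exact lt_of_pow_lt_pow_left₀ 2 hε.le (lt_of_mul_lt_mul_left h7 (by positivity))

/-- Points where the descent map loses little energy are almost critical. -/
theorem exists_defect_le (D : ℝ) {η : ℝ} (hη : 0 < η) : ∃ δ, 0 < δ ∧ ∀ v : USphere d,
    p.reduced v ≤ D → p.reduced v - p.reduced (p.descend v) ≤ δ → ‖p.defect (p.lift v)‖ ≤ η := by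
  obtain ⟨r, hr, hdesc⟩ := p.exists_descent_rate
  obtain ⟨R, hR, hbound⟩ := p.exists_norm_le_of_nehari D
  set σ := η / ((‖p.T‖ + 1) * R) with hσ
  have hσ0 : 0 < σ := by positivity
  refine ⟨r * σ ^ 2, by positivity, fun v hvD hv => ?_⟩
  set u := p.lift v with hu
  have hu0 : 0 < ‖u‖ := norm_pos_iff.2 (p.nehari_lift v).1
  have h1 : r * (‖p.iter u - u‖ / ‖u‖) ^ 2 ≤ r * σ ^ 2 := (hdesc v).trans hv
  have h2 : ‖p.iter u - u‖ / ‖u‖ ≤ σ :=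
    le_of_sq_le_sq (le_of_mul_le_mul_left h1 hr) hσ0.le
  rw [div_le_iff₀ hu0] at h2
  have h3 : p.defect u = -p.T (p.iter u - u) := by
    rw [map_sub, p.T_iter, defect, neg_sub]
  rw [h3, norm_neg]
  calc ‖p.T (p.iter u - u)‖ ≤ ‖p.T‖ * ‖p.iter u - u‖ := p.T.le_opNorm _
    _ ≤ (‖p.T‖ + 1) * (σ * R) := by
      have := hbound u (p.nehari_lift v) hvD
      gcongr
      · linarith
      · exact h2.trans (by gcongr)
    _ = η := by rw [hσ]; field_simp

/-- Pointwise limits of bounded almost critical sequences are critical. -/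
theorem defect_eq_zero_of_tendsto {u : ℕ → Ell2 d} {w : Ell2 d} {C : ℝ} (hu : ∀ n, ‖u n‖ ≤ C)
    (h : ∀ x, Tendsto (fun n => u n x) atTop (𝓝 (w x)))
    (hdef : Tendsto (fun n => ‖p.defect (u n)‖) atTop (𝓝 0)) : p.defect w = 0 := by
  classical
  ext x
  have h1 : Tendsto (fun n => p.defect (u n) x) atTop (𝓝 0) :=
    squeeze_zero_norm (fun n => abs_apply_le_norm _ x) hdef
  refine tendsto_nhds_unique ?_ h1
  have hT : ∀ z : Ell2 d, p.T z x = inner ℝ (p.T (lp.single 2 x (1 : ℝ))) z := by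
    intro z
    rw [p.T_symm, lp.inner_single_left]
    simp
  simp only [defect, lp.coeFn_sub, Pi.sub_apply, nonlin_apply, hT]
  exact (tendsto_inner_of_tendsto_pointwise hu h _).sub
    (((p.g_continuous.tendsto _).comp (h x)).mul (h x))

/-- A ray meets the Nehari set only once. -/
theorem eq_of_normalize_eq {u w : Ell2 d} (hu : p.Nehari u) (hw : p.Nehari w)
    (h : ‖u‖⁻¹ • u = ‖w‖⁻¹ • w) : u = w := by
  have h1 : ∀ z : Ell2 d, p.Nehari z → z = p.scale (‖z‖⁻¹ • z) • (‖z‖⁻¹ • z) := by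
    intro z hz
    have hz0 : 0 < ‖z‖ := norm_pos_iff.2 hz.1
    have h2 : ‖z‖ • (‖z‖⁻¹ • z) = z := by
      rw [smul_smul, mul_inv_cancel₀ hz0.ne', one_smul]
    rw [p.scale_eq_of_nehari hz0 (by rwa [h2]), h2]
  rw [h1 u hu, h1 w hw, h]

/-- Here `v`, `v'` stand for pointwise limits of unit vectors, which may be shorter than 1 or zero.
Being a nonzero solution, `u` forces ‖v‖ ≥ ρ/R. If `w` vanishes this suffices; otherwise
normalization distorts distances by at most 2/‖v‖. -/
theorem separation_aux {u w v v' : Ell2 d} {ρ R κ a b : ℝ} (hρ : 0 < ρ) (hR : 0 < R)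
    (hN : ∀ u, p.Nehari u → ρ ≤ ‖u‖)
    (hsep : ∀ u w, u ≠ 0 → w ≠ 0 → p.defect u = 0 → p.defect w = 0 → u ≠ w →
      κ ≤ ‖‖u‖⁻¹ • u - ‖w‖⁻¹ • w‖)
    (hκ : 0 < κ) (hu : p.defect u = 0) (hw : p.defect w = 0) (hne : u ≠ w) (hu0 : u ≠ 0)
    (huv : u = a • v) (hwv : w = b • v') (ha : a ∈ Icc 0 R) (hb : 0 < b) :
    ρ / (4 * R) * min κ 1 < ‖v - v'‖ := by
  have ha0 : 0 < a := by
    refine lt_of_le_of_ne ha.1 ?_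
    rintro rfl
    exact hu0 (by rw [huv, zero_smul])
  have hv0 : v ≠ 0 := by
    rintro rfl
    exact hu0 (by rw [huv, smul_zero])
  have hvn : ρ / R ≤ ‖v‖ := by
    have h1 := hN u (p.nehari_of_defect_eq_zero hu0 hu)
    rw [huv, norm_smul, Real.norm_of_nonneg ha0.le] at h1
    rw [div_le_iff₀ hR]
    nlinarith [ha.2, norm_nonneg v]
  have hρR : 0 < ρ / R := by positivity
  have hm1 : min κ 1 ≤ 1 := min_le_right _ _
  have hm0 : 0 < min κ 1 := by positivity
  have e1 : ρ / (4 * R) * min κ 1 = ρ / R * (min κ 1 / 4) := by field_simp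
  rw [e1]
  by_cases hw0 : w = 0
  · have hv'0 : v' = 0 := by
      rw [hw0] at hwv
      exact (smul_eq_zero.1 hwv.symm).resolve_left hb.ne'
    rw [hv'0, sub_zero]
    refine lt_of_lt_of_le ?_ hvn
    nlinarith
  · have hv'0 : v' ≠ 0 := by
      rintro rfl
      exact hw0 (by rw [hwv, smul_zero])
    have h1 := hsep u w hu0 hw0 hu hw hne
    have hnorm : ∀ (t : ℝ) (z : Ell2 d), 0 < t → ‖t • z‖⁻¹ • (t • z) = ‖z‖⁻¹ • z := by
      intro t z ht
      rw [norm_smul, Real.norm_of_nonneg ht.le, smul_smul, mul_inv]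
      congr 1
      field_simp
    rw [huv, hwv, hnorm a v ha0, hnorm b v' hb, norm_sub_rev] at h1
    have h2 := h1.trans (norm_normalize_sub_le hv0 hv'0)
    have hvpos : 0 < ‖v‖ := norm_pos_iff.2 hv0
    rw [mul_div_assoc', le_div_iff₀ hvpos, norm_sub_rev] at h2
    have h3 : min κ 1 * (ρ / R) ≤ κ * ‖v‖ := by
      have : min κ 1 ≤ κ := min_le_left _ _
      gcongr
    nlinarith

/-- If the normalized critical points are uniformly separated, the almost critical points form
well separated clusters on sublevel sets. -/
theorem exists_clusters {κ : ℝ} (hκ : 0 < κ)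
    (hsep : ∀ u w, u ≠ 0 → w ≠ 0 → p.defect u = 0 → p.defect w = 0 → u ≠ w →
      κ ≤ ‖‖u‖⁻¹ • u - ‖w‖⁻¹ • w‖) (D : ℝ) :
    ∃ κ', 0 < κ' ∧ ∀ ε, 0 < ε → ∃ δ, 0 < δ ∧ ∀ v w : USphere d, p.reduced v ≤ D →
      p.reduced w ≤ D → p.reduced v - p.reduced (p.descend v) ≤ δ →
      p.reduced w - p.reduced (p.descend w) ≤ δ → dist v w < ε ∨ κ' ≤ dist v w := by
  obtain ⟨ρ, hρ, hN⟩ := p.exists_le_norm_of_nehari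
  obtain ⟨R, hR, hbound⟩ := p.exists_norm_le_of_nehari D
  refine ⟨ρ / (4 * R) * min κ 1, by positivity, fun ε hε => ?_⟩
  obtain ⟨δ₁, hδ₁, hsmall⟩ := p.exists_norm_sub_lt hR (ε := ε * ρ / 2) (by positivity)
  have hex : ∀ η : ℝ, 0 < η → ∃ δ, 0 < δ ∧ ∀ v : USphere d, p.reduced v ≤ D →
      p.reduced v - p.reduced (p.descend v) ≤ δ → ‖p.defect (p.lift v)‖ ≤ η :=
    fun η hη => p.exists_defect_le D hη
  by_contra! hcon
  have hstep : ∀ n : ℕ, ∃ (v w : USphere d) (x : Lattice d),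
      ‖p.lift v‖ ≤ R ∧ ‖p.lift w‖ ≤ R ∧ ‖p.defect (p.lift v)‖ ≤ 1 / ((n : ℝ) + 1) ∧
      ‖p.defect (p.lift w)‖ ≤ 1 / ((n : ℝ) + 1) ∧
      dist v w < ρ / (4 * R) * min κ 1 ∧ δ₁ < |p.lift v x - p.lift w x| := by
    intro n
    obtain ⟨δ, hδ, hdef⟩ := hex (min δ₁ (1 / ((n : ℝ) + 1))) (by positivity)
    obtain ⟨v, w, hvD, hwD, hv, hw, hvw, hvw'⟩ := hcon δ hδ
    have hv1 := hdef v hvD hv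
    have hw1 := hdef w hwD hw
    have hvR := hbound _ (p.nehari_lift v) hvD
    have hwR := hbound _ (p.nehari_lift w) hwD
    -- Otherwise the lifts would be within ερ/2 in ℓ², hence their normalizations within ε.
    have hxx : ∃ x, δ₁ < |p.lift v x - p.lift w x| := by
      by_contra! hx
      have h1 := hsmall _ _ hvR hwR (hv1.trans (min_le_left _ _)) (hw1.trans (min_le_left _ _)) hx
      have h2 := norm_normalize_sub_le (p.nehari_lift w).1 (p.nehari_lift v).1
      rw [p.normalize_lift, p.normalize_lift, ← dist_eq_norm, ← Subtype.dist_eq] at h2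
      have h3 : ρ ≤ ‖p.lift w‖ := hN _ (p.nehari_lift w)
      have h4 : 0 < ‖p.lift w‖ := hρ.trans_le h3
      rw [mul_div_assoc', le_div_iff₀ h4] at h2
      nlinarith [dist_nonneg (x := v) (y := w)]
    obtain ⟨x, hx⟩ := hxx
    exact ⟨v, w, x, hvR, hwR, hv1.trans (min_le_right _ _), hw1.trans (min_le_right _ _), hvw', hx⟩
  choose v w x hvR hwR hvd hwd hvw hx using hstep
  -- Translate the site of difference to the origin: there the two limits remain distinct, so at
  -- least one of them is nonzero.
  have hnv : ∀ (z : ℕ → USphere d) (n : ℕ), ‖shift (-x n) (z n : Ell2 d)‖ ≤ 1 := fun z n => by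
    rw [LinearIsometry.norm_map, norm_eq_of_mem_sphere]
  have hscale : ∀ z : USphere d, ‖p.lift z‖ ≤ R → p.scale z ∈ Icc 0 R := fun z hz =>
    ⟨(p.scale_pos _).le, by rwa [← p.norm_lift]⟩
  obtain ⟨φ, v', w', a, b, hφ, hv', hw', ha, hb⟩ := exists_subseq_tendsto (hnv v) (hnv w)
    (fun n => hscale _ (hvR n)) (fun n => hscale _ (hwR n))
  have hab : ∀ (z : ℕ → USphere d) (t : ℝ),
      Tendsto (fun n => p.scale (z (φ n))) atTop (𝓝 t) → (∀ n, ‖p.lift (z n)‖ ≤ R) →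
      t ∈ Icc 0 R ∧ 0 < t := by
    intro z t ht hz
    have h1 : ρ ≤ t := ge_of_tendsto' ht fun n => by
      rw [← p.norm_lift]
      exact hN _ (p.nehari_lift _)
    exact ⟨⟨hρ.le.trans h1, le_of_tendsto' ht fun n => (hscale _ (hz _)).2⟩, hρ.trans_le h1⟩
  have hone : Tendsto (fun n : ℕ => 1 / ((φ n : ℝ) + 1)) atTop (𝓝 0) :=
    (tendsto_one_div_add_atTop_nhds_zero_nat (𝕜 := ℝ)).comp hφ.tendsto_atTop
  have hcrit : ∀ (z : ℕ → USphere d) (z' : Ell2 d) (t : ℝ),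
      (∀ y, Tendsto (fun n => shift (-x (φ n)) (z (φ n) : Ell2 d) y) atTop (𝓝 (z' y))) →
      Tendsto (fun n => p.scale (z (φ n))) atTop (𝓝 t) → (∀ n, ‖p.lift (z n)‖ ≤ R) →
      (∀ n, ‖p.defect (p.lift (z n))‖ ≤ 1 / ((n : ℝ) + 1)) →
      (∀ y, Tendsto (fun n => shift (-x (φ n)) (p.lift (z (φ n))) y) atTop (𝓝 ((t • z') y))) ∧
      p.defect (t • z') = 0 := by
    intro z z' t hz' ht hzR hzd
    have h1 : ∀ y, Tendsto (fun n => shift (-x (φ n)) (p.lift (z (φ n))) y) atTop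
        (𝓝 ((t • z') y)) := fun y => ht.mul (hz' y)
    refine ⟨h1, p.defect_eq_zero_of_tendsto (C := R) (fun n => ?_) h1 ?_⟩
    · rw [LinearIsometry.norm_map]
      exact hzR _
    · refine squeeze_zero (fun n => norm_nonneg _) (fun n => ?_) hone
      rw [p.defect_shift, LinearIsometry.norm_map]
      exact hzd _
  obtain ⟨hav, hcv⟩ := hcrit v v' a hv' ha hvR hvd
  obtain ⟨hbw, hcw⟩ := hcrit w w' b hw' hb hwR hwd
  obtain ⟨haI, ha0⟩ := hab v a ha hvR
  obtain ⟨hbI, hb0⟩ := hab w b hb hwR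
  have hne : a • v' ≠ b • w' := by
    intro h
    have h1 := ((hav 0).sub (hbw 0)).abs
    rw [h, sub_self, abs_zero] at h1
    have h2 : δ₁ ≤ 0 := ge_of_tendsto' h1 fun n => by
      simpa using (hx (φ n)).le
    linarith
  have hdist : ‖v' - w'‖ ≤ ρ / (4 * R) * min κ 1 := by
    refine norm_le_of_tendsto_pointwise
      (v := fun n => shift (-x (φ n)) (v (φ n) : Ell2 d) - shift (-x (φ n)) (w (φ n) : Ell2 d))
      (fun n => ?_) fun y => (hv' y).sub (hw' y)
    rw [← map_sub, LinearIsometry.norm_map, ← dist_eq_norm]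
    exact (hvw (φ n)).le
  by_cases hv0 : a • v' = 0
  · have hw0 : b • w' ≠ 0 := fun h => hne (by rw [hv0, h])
    have := p.separation_aux hρ hR hN hsep hκ hcw hcv hne.symm hw0 rfl rfl hbI ha0
    rw [norm_sub_rev] at this
    linarith
  · have := p.separation_aux hρ hR hN hsep hκ hcv hcw hne hv0 rfl rfl haI hb0
    linarith

end Problem

end Multiplicity

/-! ### Infinitely many critical orbits and the theorem -/

section Conclusion

open Filter Topology

variable {d : ℕ}

namespace Problem

variable (p : Problem d)

/-- A critical point of the reduced energy gives a solution. -/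
theorem defect_lift_eq_zero {v : USphere d} (hv : p.descend v = v) : p.defect (p.lift v) = 0 := by
  obtain ⟨r, hr, hdesc⟩ := p.exists_descent_rate
  have h1 := hdesc v
  rw [hv, sub_self] at h1
  have hu0 : 0 < ‖p.lift v‖ := norm_pos_iff.2 (p.nehari_lift v).1
  have h2 : (‖p.iter (p.lift v) - p.lift v‖ / ‖p.lift v‖) ^ 2 = 0 := by
    refine le_antisymm ?_ (sq_nonneg _)
    by_contra! h
    linarith [mul_pos hr h]
  have h3 : p.iter (p.lift v) = p.lift v := by
    have := (div_eq_zero_iff.1 (pow_eq_zero_iff (two_ne_zero) |>.1 h2)).resolve_right hu0.ne'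
    exact sub_eq_zero.1 (norm_eq_zero.1 this)
  have h4 := p.T_iter (p.lift v)
  rw [h3] at h4
  rw [defect, h4, sub_self]

/-- The normalized fixed point iteration as a descent system. -/
noncomputable def descentSystem {κ : ℝ} (hκ : 0 < κ)
    (hsep : ∀ u w, u ≠ 0 → w ≠ 0 → p.defect u = 0 → p.defect w = 0 → u ≠ w →
      κ ≤ ‖‖u‖⁻¹ • u - ‖w‖⁻¹ • w‖) : DescentSystem (USphere d) where
  map := p.descend
  energy := p.reduced
  -- Normalization at most doubles relative distances, hence 4 after squaring.
  rate := Classical.choose p.exists_descent_rate / 4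
  dist_neg v w := by
    rw [Subtype.dist_eq, Subtype.dist_eq, coe_neg_sphere, coe_neg_sphere, dist_neg_neg]
  continuous_map := p.continuous_descend
  continuous_energy := p.continuous_action.comp p.continuous_lift
  map_neg := p.descend_neg
  energy_neg v := by rw [reduced, lift_neg, action_neg, reduced]
  energy_nonneg v := (p.nehari_lift v).action_nonneg
  rate_pos := by
    have := (Classical.choose_spec p.exists_descent_rate).1
    positivity
  descent v := by
    have hr := (Classical.choose_spec p.exists_descent_rate).1
    refine le_trans ?_ ((Classical.choose_spec p.exists_descent_rate).2 v)
    have h1 := norm_normalize_sub_le (p.nehari_lift v).1 (p.nehari_lift v).iter_ne_zero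
    rw [p.normalize_lift] at h1
    have h2 : dist (p.descend v) v ≤ 2 * (‖p.iter (p.lift v) - p.lift v‖ / ‖p.lift v‖) := by
      rw [Subtype.dist_eq, dist_eq_norm]
      exact h1
    have h3 : dist (p.descend v) v ^ 2 ≤
        (2 * (‖p.iter (p.lift v) - p.lift v‖ / ‖p.lift v‖)) ^ 2 := by gcongr
    nlinarith
  clusters := p.exists_clusters hκ hsep

/-- Finitely many critical orbits give uniformly separated normalized critical points. -/
theorem exists_separation (F : Finset (Ell2 d))
    (hF : ∀ u, u ≠ 0 → p.defect u = 0 → ∃ q ∈ F, ∃ y, u = shift y q ∨ u = -shift y q) :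
    ∃ κ, 0 < κ ∧ ∀ u w, u ≠ 0 → w ≠ 0 → p.defect u = 0 → p.defect w = 0 → u ≠ w →
      κ ≤ ‖‖u‖⁻¹ • u - ‖w‖⁻¹ • w‖ := by
  classical
  set N : Ell2 d → Ell2 d := fun u => ‖u‖⁻¹ • u with hNdef
  obtain ⟨κ, hκ, h⟩ := exists_separation_orbits (F.image N ∪ F.image fun q => N (-q))
  refine ⟨κ, hκ, fun u w hu hw hdu hdw hne => ?_⟩
  have key : ∀ u, u ≠ 0 → p.defect u = 0 →
      ∃ q ∈ F.image N ∪ F.image fun q => N (-q), ∃ y, ‖u‖⁻¹ • u = shift y q := by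
    intro u hu hdu
    obtain ⟨q, hq, y, rfl | rfl⟩ := hF u hu hdu
    · refine ⟨N q, Finset.mem_union_left _ (Finset.mem_image_of_mem N hq), y, ?_⟩
      rw [LinearIsometry.norm_map, ← map_smul]
    · refine ⟨N (-q), Finset.mem_union_right _ (Finset.mem_image_of_mem (fun q => N (-q)) hq), y, ?_⟩
      rw [← map_neg, LinearIsometry.norm_map, ← map_smul]
  obtain ⟨q, hq, y, hy⟩ := key u hu hdu
  obtain ⟨r, hr, z, hz⟩ := key w hw hdw
  rw [hy, hz]
  refine h q hq r hr y z fun heq => hne ?_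
  exact p.eq_of_normalize_eq (p.nehari_of_defect_eq_zero hu hdu) (p.nehari_of_defect_eq_zero hw hdw)
    (by rw [hy, hz, heq])

end Problem

theorem exists_orthonormal (hd : 1 ≤ d) : ∃ e : ℕ → Ell2 d, Orthonormal ℝ e := by
  classical
  have : Nonempty (Fin d) := ⟨⟨0, hd⟩⟩
  let ι := Infinite.natEmbedding (Lattice d)
  refine ⟨fun n => lp.single 2 (ι n) (1 : ℝ), ?_⟩
  rw [orthonormal_iff_ite]
  intro m n
  rw [lp.inner_single_left, lp.single_apply]
  by_cases h : m = n
  · subst h; simp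
  · simp [h]

/-- The finite-dimensional unit spheres have large genus. -/
theorem not_genusLE_sphere {e : ℕ → Ell2 d} (he : Orthonormal ℝ e) (m : ℕ) :
    ¬ GenusLE {v : USphere d | (v : Ell2 d) ∈ Submodule.span ℝ (e '' Iic m)} m := by
  rintro ⟨C, hC, hcov⟩
  -- On each compact product ‖x + y‖ is continuous and never zero, so compactness turns absence of
  -- antipodal pairs into uniform separation.
  obtain ⟨ε, hε, hsep⟩ := exists_pos_forall_of_finite (Set.finite_Iio m)
    (P := fun ε i => ∀ x ∈ C i, ∀ y ∈ C i, ε ≤ ‖(x : Ell2 d) + y‖)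
    (fun i κ κ' hle h x hx y hy => hle.trans (h x hx y hy)) (fun i hi => by
      have hcont : Continuous fun q : USphere d × USphere d => ‖(q.1 : Ell2 d) + q.2‖ := by fun_prop
      obtain ⟨ε, hε, h⟩ := ((hC i hi).1.prod (hC i hi).1).exists_forall_le' (a := 0)
        hcont.continuousOn (by
          rintro ⟨x, y⟩ ⟨hx, hy⟩
          rw [norm_pos_iff]
          intro h
          refine (hC i hi).2 x hx ?_
          have : -x = y := by
            ext1
            rw [coe_neg_sphere]
            exact neg_eq_of_add_eq_zero_right h
          rwa [this])
      exact ⟨ε, hε, fun x hx y hy => h (x, y) ⟨hx, hy⟩⟩)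
  refine lusternik_schnirelmann he m (fun i => (↑) '' C i) hε ?_ ?_
  · rintro i hi _ ⟨x, hx, rfl⟩ _ ⟨y, hy, rfl⟩
    exact hsep i hi x hx y hy
  · intro x hx hx1
    obtain ⟨i, hi, h | h⟩ := hcov ⟨x, mem_sphere_zero_iff_norm.2 hx1⟩ hx
    · exact ⟨i, hi, Or.inl ⟨_, h, rfl⟩⟩
    · exact ⟨i, hi, Or.inr ⟨_, h, rfl⟩⟩

theorem isCompact_sphere_span (e : ℕ → Ell2 d) (m : ℕ) :
    IsCompact {v : USphere d | (v : Ell2 d) ∈ Submodule.span ℝ (e '' Iic m)} := by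
  set W := Submodule.span ℝ (e '' Iic m) with hW
  have : FiniteDimensional ℝ W := FiniteDimensional.span_of_finite ℝ ((finite_Iic m).image e)
  have : ProperSpace W := FiniteDimensional.proper_real W
  rw [Topology.IsEmbedding.subtypeVal.isCompact_iff]
  have h1 : IsCompact ((↑) '' Metric.sphere (0 : W) 1 : Set (Ell2 d)) :=
    (isCompact_sphere (0 : W) 1).image continuous_subtype_val
  convert h1 using 1
  ext x
  constructor
  · rintro ⟨v, hv, rfl⟩
    refine ⟨⟨v, hv⟩, ?_, rfl⟩
    rw [mem_sphere_zero_iff_norm]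
    exact norm_eq_of_mem_sphere v
  · rintro ⟨w, hw, rfl⟩
    rw [mem_sphere_zero_iff_norm] at hw
    exact ⟨⟨w, mem_sphere_zero_iff_norm.2 hw⟩, w.2, rfl⟩

/-- There are infinitely many critical orbits. -/
theorem Problem.infinite_orbits (p : Problem d) (hd : 1 ≤ d) (F : Finset (Ell2 d)) :
    ∃ u, u ≠ 0 ∧ p.defect u = 0 ∧ ∀ q ∈ F, ∀ y, u ≠ shift y q ∧ u ≠ -shift y q := by
  classical
  by_contra! hcon
  have hF : ∀ u, u ≠ 0 → p.defect u = 0 → ∃ q ∈ F, ∃ y, u = shift y q ∨ u = -shift y q := by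
    intro u hu hdu
    obtain ⟨q, hq, y, h⟩ := hcon u hu hdu
    exact ⟨q, hq, y, or_iff_not_imp_left.2 h⟩
  obtain ⟨κ, hκ, hsep⟩ := p.exists_separation F hF
  obtain ⟨e, he⟩ := exists_orthonormal hd
  have : CompleteSpace (USphere d) := Metric.isClosed_sphere.completeSpace_coe
  set S := p.descentSystem hκ hsep
  -- The energy is invariant under translation and sign, so `V` contains every critical value; a
  -- sphere of dimension `V.card` then has too large a genus.
  set V := F.image p.action with hV
  refine not_genusLE_sphere he V.card (S.genusLE ?_ V ?_ V.card _ (isCompact_sphere_span e V.card)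
    (fun v hv => ?_) (Finset.card_filter_le _ _))
  · exact fun v h => ne_neg_of_mem_unit_sphere ℝ v h.symm
  · intro v hv
    obtain ⟨q, hq, y, h | h⟩ := hF (p.lift v) (p.nehari_lift v).1 (p.defect_lift_eq_zero hv)
    · refine Finset.mem_image.2 ⟨q, hq, ?_⟩
      change p.action q = p.action (p.lift v)
      rw [h, p.action_shift]
    · refine Finset.mem_image.2 ⟨q, hq, ?_⟩
      change p.action q = p.action (p.lift v)
      rw [h, p.action_neg, p.action_shift]
  · rw [mem_ofPred_eq, coe_neg_sphere]
    exact Submodule.neg_mem _ hv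

/-! ### Geometric distinctness -/

theorem exists_eq_shift_of_not_distinct {u w : Ell2 d} (h : ¬ GeometricallyDistinct u w) :
    ∃ y, w = shift y u := by
  obtain ⟨φ, ⟨y, hy⟩, ⟨z, hz⟩⟩ := Set.not_disjoint_iff.1 h
  refine ⟨y - z, ?_⟩
  ext x
  have h1 := congrFun (hy.trans hz.symm) (x + z)
  simp only [add_sub_cancel_right] at h1
  rw [shift_apply, ← h1, sub_sub_eq_add_sub]

/-- If -u were a translate of u, then |u| would be periodic in a nonzero direction, which
contradicts decay at infinity. -/
theorem geometricallyDistinct_neg {u : Ell2 d} (hu : u ≠ 0) : GeometricallyDistinct u (-u) := by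
  by_contra hcon
  obtain ⟨y, hy⟩ := exists_eq_shift_of_not_distinct hcon
  obtain ⟨x, hx⟩ : ∃ x, u x ≠ 0 := by
    by_contra! h
    exact hu (lp.ext (funext h))
  have hval : ∀ z, u (z - y) = -u z := by
    intro z
    rw [← shift_apply, ← hy]
    rfl
  have hy0 : y ≠ 0 := by
    rintro rfl
    have := hval x
    rw [sub_zero] at this
    exact hx (by linarith)
  have habs : ∀ n : ℕ, |u (x - n • y)| = |u x| := by
    intro n
    induction n with
    | zero => simp
    | succ n ih => rw [succ_nsmul, ← sub_sub, hval, abs_neg, ih]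
  have hlim : Tendsto (fun z => |u z| ^ 2) cofinite (𝓝 0) := by
    have := ((lp.memℓp u).summable (by norm_num)).tendsto_cofinite_zero
    simpa using this
  have hfin : {z | ¬ |u z| ^ 2 < |u x| ^ 2}.Finite :=
    hlim.eventually (gt_mem_nhds (by positivity))
  refine Set.infinite_of_injective_forall_mem (f := fun n : ℕ => x - n • y) ?_ (fun n => ?_) hfin
  · intro m n hmn
    have h1 : m • y = n • y := sub_right_injective hmn
    obtain ⟨i, hi⟩ := Function.ne_iff.1 hy0
    have h2 := congrFun h1 i
    simp only [Pi.smul_apply, nsmul_eq_mul] at h2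
    exact_mod_cast mul_right_cancel₀ hi h2
  · simp only [mem_ofPred_eq, habs, lt_irrefl, not_false_iff]

/-- Periods form a subgroup, here containing generators of the lattice. -/
theorem eq_of_periodic {β : Type*} {φ : Lattice d → β}
    (h : ∀ i x, φ (x + Pi.single i 1) = φ x) (x : Lattice d) : φ x = φ 0 := by
  let S : AddSubgroup (Lattice d) :=
    { carrier := {y | ∀ x, φ (x + y) = φ x}
      add_mem' := fun {a b} ha hb x => by rw [← add_assoc, hb, ha]
      zero_mem' := fun x => by rw [add_zero]
      neg_mem' := fun {a} ha x => by rw [← ha (x + -a), neg_add_cancel_right] }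
  have hx : x ∈ S := by
    rw [← Finset.univ_sum_single x]
    refine S.sum_mem fun i _ => ?_
    have h1 : (Pi.single i (x i) : Lattice d) = x i • Pi.single i 1 := by
      rw [← Pi.single_smul]; simp
    rw [h1]
    exact S.zsmul_mem (h i) _
  have := hx 0
  rwa [zero_add] at this

/-! ### The nonlinearity -/

section Nonlinearity

variable {f : ℝ → ℝ}

theorem apply_zero_of_odd (hodd : ∀ u, f (-u) = -f u) : f 0 = 0 := by
  have := hodd 0
  rw [neg_zero] at this
  linarith

theorem div_self_mul (hodd : ∀ u, f (-u) = -f u) (s : ℝ) : f s / s * s = f s := by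
  by_cases hs : s = 0
  · rw [hs, apply_zero_of_odd hodd, mul_zero]
  · exact div_mul_cancel₀ _ hs

/-- The default value of the quotient at 0 is 0, which is the limit given by f(u) = o(u). -/
theorem continuous_quotient (hf : Continuous f)
    (h3 : ∀ ε : ℝ, 0 < ε → ∃ δ : ℝ, 0 < δ ∧ ∀ u, |u| < δ → |f u| ≤ ε * |u|) :
    Continuous fun s => f s / s := by
  rw [continuous_iff_continuousAt]
  intro s
  by_cases hs : s = 0
  · subst hs
    rw [Metric.continuousAt_iff]
    intro ε hε
    obtain ⟨δ, hδ, h⟩ := h3 (ε / 2) (half_pos hε)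
    refine ⟨δ, hδ, fun {u} hu => ?_⟩
    rw [Real.dist_eq, sub_zero] at hu
    rw [Real.dist_eq, div_zero, sub_zero, abs_div]
    refine lt_of_le_of_lt (div_le_of_le_mul₀ (abs_nonneg _) (by positivity) (h u hu))
      (half_lt_self hε)
  · exact hf.continuousAt.div continuousAt_id hs

theorem strictMonoOn_quotient (hf : Continuous f)
    (h3 : ∀ ε : ℝ, 0 < ε → ∃ δ : ℝ, 0 < δ ∧ ∀ u, |u| < δ → |f u| ≤ ε * |u|)
    (h4 : StrictMonoOn (fun u : ℝ => f u / |u|) (Ioi 0)) :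
    StrictMonoOn (fun s => f s / s) (Ici 0) := by
  have hpos : ∀ s t : ℝ, 0 < s → s < t → f s / s < f t / t := by
    intro s t hs hst
    have := h4 hs (hs.trans hst) hst
    simpa only [abs_of_pos hs, abs_of_pos (hs.trans hst)] using this
  intro s hs t _ hst
  rcases (mem_Ici.1 hs).lt_or_eq with h | rfl
  · exact hpos s t h hst
  · have hlim : Tendsto (fun r => f r / r) (𝓝[>] 0) (𝓝 (f 0 / 0)) :=
      ((continuous_quotient hf h3).tendsto 0).mono_left nhdsWithin_le_nhds
    -- Passing to the limit at 0 only gives a weak inequality; stopping at t/2 leaves room for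
    -- strictness.
    have h1 : f 0 / 0 ≤ f (t / 2) / (t / 2) := by
      refine le_of_tendsto hlim ?_
      filter_upwards [Ioo_mem_nhdsGT (half_pos hst)] with r hr
      exact (hpos r (t / 2) hr.1 hr.2).le
    exact h1.trans_lt (hpos (t / 2) t (half_pos hst) (half_lt_self hst))

theorem integral_abs_of_odd (hodd : ∀ u, f (-u) = -f u) (s : ℝ) :
    ∫ t in (0 : ℝ)..|s|, f t = ∫ t in (0 : ℝ)..s, f t := by
  rcases abs_choice s with h | h
  · rw [h]
  · rw [h]
    have h1 := intervalIntegral.integral_comp_neg (a := 0) (b := s) f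
    simp only [hodd, intervalIntegral.integral_neg, neg_zero] at h1
    rw [intervalIntegral.integral_symm, ← h1, neg_neg]

/-- For nonnegative arguments, monotonicity of f(t)/t compares f with the line of slope f(a)/a on
either side of a; integrate. Evenness covers the other signs. -/
theorem le_integral_sub_integral (hf : Continuous f) (hodd : ∀ u, f (-u) = -f u)
    (h3 : ∀ ε : ℝ, 0 < ε → ∃ δ : ℝ, 0 < δ ∧ ∀ u, |u| < δ → |f u| ≤ ε * |u|)
    (h4 : StrictMonoOn (fun u : ℝ => f u / |u|) (Ioi 0)) (a b : ℝ) :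
    f a / a * (b ^ 2 - a ^ 2) / 2 ≤ (∫ t in (0 : ℝ)..b, f t) - ∫ t in (0 : ℝ)..a, f t := by
  have hmono := (strictMonoOn_quotient hf h3 h4).monotoneOn
  have hint : ∀ a b, IntervalIntegrable f volume a b := fun a b => hf.intervalIntegrable a b
  have key : ∀ a b : ℝ, 0 ≤ a → 0 ≤ b →
      f a / a * (b ^ 2 - a ^ 2) / 2 ≤ (∫ t in (0 : ℝ)..b, f t) - ∫ t in (0 : ℝ)..a, f t := by
    intro a b ha hb
    rw [intervalIntegral.integral_interval_sub_left (hint _ _) (hint _ _)]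
    have hlin : ∀ x y : ℝ, ∫ t in x..y, f a / a * t = f a / a * (y ^ 2 - x ^ 2) / 2 := by
      intro x y
      rw [intervalIntegral.integral_const_mul, integral_id]
      ring
    have hlint : ∀ x y : ℝ, IntervalIntegrable (fun t => f a / a * t) volume x y := fun x y =>
      (continuous_const.mul continuous_id).intervalIntegrable x y
    rcases le_total a b with hab | hab
    · rw [← hlin]
      refine intervalIntegral.integral_mono_on hab (hlint _ _) (hint _ _) fun t ht => ?_
      rw [← div_self_mul hodd t]
      exact mul_le_mul_of_nonneg_right (hmono ha (ha.trans ht.1) ht.1) (ha.trans ht.1)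
    · rw [intervalIntegral.integral_symm]
      have h1 : ∫ t in b..a, f t ≤ ∫ t in b..a, f a / a * t := by
        refine intervalIntegral.integral_mono_on hab (hint _ _) (hlint _ _) fun t ht => ?_
        rw [← div_self_mul hodd t]
        exact mul_le_mul_of_nonneg_right (hmono (hb.trans ht.1) ha ht.2) (hb.trans ht.1)
      rw [hlin] at h1
      linarith
  have hq : f |a| / |a| = f a / a := by
    rcases abs_choice a with h | h <;> rw [h]
    rw [hodd, neg_div_neg_eq]
  have := key |a| |b| (abs_nonneg a) (abs_nonneg b)
  rwa [hq, sq_abs, sq_abs, integral_abs_of_odd hodd, integral_abs_of_odd hodd] at this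

/-- The variational problem for `(-Δ)^α u + c u = f(u)`. -/
noncomputable def Problem.ofNonlinearity {α : ℝ} (hα : 0 ≤ α) {c : ℝ} (hc : 0 < c)
    (hf : Continuous f) (hodd : ∀ u, f (-u) = -f u)
    (h3 : ∀ ε : ℝ, 0 < ε → ∃ δ : ℝ, 0 < δ ∧ ∀ u, |u| < δ → |f u| ≤ ε * |u|)
    (h4 : StrictMonoOn (fun u : ℝ => f u / |u|) (Ioi 0))
    (h5 : ∀ M : ℝ, ∃ R : ℝ, 0 < R ∧ ∀ u, R < |u| → M ≤ (∫ t in (0 : ℝ)..u, f t) / u ^ 2) :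
    Problem d where
  T := laplacian hα + c • ContinuousLinearMap.id ℝ (Ell2 d)
  c := c
  g s := f s / s
  prim u := ∫ t in (0 : ℝ)..u, f t
  c_pos := hc
  T_symm u w := by
    simp [inner_add_left, inner_add_right, inner_smul_left, inner_smul_right,
      inner_laplacian_comm]
  T_coercive u := by
    have := inner_laplacian_self_nonneg hα u
    simp only [add_apply, smul_apply,
      ContinuousLinearMap.id_apply, inner_add_left, inner_smul_left, real_inner_self_eq_norm_sq,
      conj_trivial]
    linarith
  T_shift y u := by simp [laplacian_shift]
  g_continuous := continuous_quotient hf h3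
  g_neg s := by rw [hodd, neg_div_neg_eq]
  g_zero := div_zero _
  g_strictMono := strictMonoOn_quotient hf h3 h4
  prim_zero := intervalIntegral.integral_same
  prim_sub := le_integral_sub_integral hf hodd h3 h4
  prim_superquadratic M := by
    obtain ⟨R, hR, h⟩ := h5 M
    refine ⟨R, hR, fun s hs => ?_⟩
    have hs0 : s ≠ 0 := abs_pos.1 (hR.trans hs)
    exact (le_div_iff₀ (by positivity)).1 (h s hs)

end Nonlinearity

end Conclusion

end DiscreteFractional

theorem theorem1p2 (d : ℕ) (hd : 1 ≤ d) (α : ℝ) (hα0 : 0 < α) (hα1 : α < 1)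
    (h : DiscreteFractional.Lattice d → ℝ) (f : DiscreteFractional.Lattice d → ℝ → ℝ)
    -- (h1)
    (h1 : ∃ c₁ c₂ : ℝ, 0 < c₁ ∧ 0 < c₂ ∧ ∀ x, c₁ ≤ h x ∧ h x ≤ c₂)
    -- (f1)
    (f1 : ∀ x, Continuous (f x))
    -- (f2)
    (f2 : ∃ a p : ℝ, 0 < a ∧ 2 < p ∧ ∀ x u, |f x u| ≤ a * (1 + |u| ^ (p - 1)))
    -- (f3)
    (f3 : ∀ ε : ℝ, 0 < ε → ∃ δ : ℝ, 0 < δ ∧ ∀ x u, |u| < δ → |f x u| ≤ ε * |u|)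
    -- (f4)
    (f4 : ∀ x, StrictMonoOn (fun u : ℝ => f x u / |u|) (Set.Iio 0) ∧
      StrictMonoOn (fun u : ℝ => f x u / |u|) (Set.Ioi 0))
    -- (f5)
    (f5 : ∀ M : ℝ, ∃ R : ℝ, 0 < R ∧ ∀ x u, R < |u| → M ≤ (∫ t in (0 : ℝ)..u, f x t) / u ^ 2)
    -- (f6)
    (f6 : ∀ (i : Fin d) (x : DiscreteFractional.Lattice d),
      h (x + Pi.single i 1) = h x ∧ ∀ u : ℝ, f (x + Pi.single i 1) u = f x u)
    (f_odd : ∀ x u, f x (-u) = -f x u) :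
    ∃ u : ℕ → DiscreteFractional.Ell2 d,
      (∀ n, u n ≠ 0 ∧
        u n ∈ DiscreteFractional.HAlpha α h ∧ DiscreteFractional.IsSolution α h f (u n) ∧
        -u n ∈ DiscreteFractional.HAlpha α h ∧ DiscreteFractional.IsSolution α h f (-u n) ∧
        DiscreteFractional.GeometricallyDistinct (u n) (-u n)) ∧
      ∀ m n, m ≠ n →
        DiscreteFractional.GeometricallyDistinct (u m) (u n) ∧
        DiscreteFractional.GeometricallyDistinct (u m) (-u n) ∧
        DiscreteFractional.GeometricallyDistinct (-u m) (u n) ∧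
        DiscreteFractional.GeometricallyDistinct (-u m) (-u n) := by
  open DiscreteFractional in
  obtain ⟨c₁, c₂, hc₁, hc₂, hh⟩ := h1
  have hconst : ∀ x, h x = h 0 := eq_of_periodic fun i x => (f6 i x).1
  have fconst : ∀ x, f x = f 0 := eq_of_periodic fun i x => funext (f6 i x).2
  have hmem : ∀ u, u ∈ HAlpha α h := mem_HAlpha hα0.le (b := c₂) fun x => by
    rw [abs_of_nonneg (hc₁.le.trans (hh x).1)]
    exact (hh x).2
  let p : Problem d := Problem.ofNonlinearity (f := f 0) hα0.le (hc₁.trans_le (hh 0).1) (f1 0)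
    (f_odd 0)
    (fun ε hε => (f3 ε hε).imp fun δ hδ => ⟨hδ.1, hδ.2 0⟩) (f4 0).2
    (fun M => (f5 M).imp fun R hR => ⟨hR.1, hR.2 0⟩)
  have hsol : ∀ u, p.defect u = 0 → IsSolution α h f u := by
    intro u hu x
    have h2 : laplacian hα0.le u x + h 0 * u x - f 0 (u x) / u x * u x = 0 :=
      congrArg (fun w : Ell2 d => w x) hu
    rw [div_self_mul (f_odd 0)] at h2
    rw [fracLaplacian_eq_laplacian hα0.le, hconst, fconst, ← Complex.ofReal_add]
    congr 1
    linarith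
  have hneg : ∀ u, p.defect u = 0 → p.defect (-u) = 0 := by
    intro u hu
    rw [Problem.defect, map_neg, Problem.nonlin_neg, neg_sub_neg, ← neg_sub, ← Problem.defect, hu,
      neg_zero]
  -- Greedy choice: each new solution avoids the translates, up to sign, of all earlier ones.
  obtain ⟨u, hu, hur⟩ := exists_seq_of_forall_finset_exists
    (fun u : Ell2 d => u ≠ 0 ∧ p.defect u = 0)
    (fun q u => ∀ y, u ≠ shift y q ∧ u ≠ -shift y q) fun F _ => by
      obtain ⟨u, hu0, hu, hF⟩ := p.infinite_orbits hd F
      exact ⟨u, ⟨hu0, hu⟩, hF⟩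
  refine ⟨u, fun n => ⟨(hu n).1, hmem _, hsol _ (hu n).2, hmem _, hsol _ (hneg _ (hu n).2),
    geometricallyDistinct_neg (hu n).1⟩, ?_⟩
  have key : ∀ m n, m < n → GeometricallyDistinct (u m) (u n) ∧
      GeometricallyDistinct (u m) (-u n) ∧ GeometricallyDistinct (-u m) (u n) ∧
      GeometricallyDistinct (-u m) (-u n) := by
    intro m n hmn
    refine ⟨?_, ?_, ?_, ?_⟩ <;> by_contra hcon <;>
      obtain ⟨y, hy⟩ := exists_eq_shift_of_not_distinct hcon
    · exact (hur m n hmn y).1 hy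
    · exact (hur m n hmn y).2 (neg_eq_iff_eq_neg.1 hy)
    · exact (hur m n hmn y).2 (by rw [hy, map_neg])
    · exact (hur m n hmn y).1 (by rw [map_neg] at hy; exact neg_injective hy)
  intro m n hmn
  rcases hmn.lt_or_gt with hlt | hlt
  · exact key m n hlt
  · obtain ⟨h1, h2, h3, h4⟩ := key n m hlt
    exact ⟨h1.symm, h3.symm, h2.symm, h4.symm⟩
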